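/- **Setting.** Let $k\ge 1$, let $\Omega\subset\mathbb R^k$ be a bounded domain, and let $\Omega_\Delta=\{\Omega_\alpha\}_{\alpha\in\Delta}$ be a finite rectangular partition of $\Omega$: each $\Omega_\alpha$ is nonempty and is the intersection of $\Omega$ with an open box, distinct cells meet in a null set, and the cells cover $\Omega$ up to a null set. Put $v(\Omega_\Delta)=\min_\alpha \mathcal L^k(\Omega_\alpha)$. Let $H_\Delta\subset L^2(\Omega;\mathbb R^\ell)$ be the space of maps $U$ that are constant, with value $U^\alpha$, on each $\Omega_\alpha$, with the $L^2$ inner product and norm. For $E_{\alpha\beta}=\overline{\partial\Omega_\alpha\cap\partial\Omega_\beta}$ let $$TV_\Delta(U)=\sum_{\{\alpha,\beta\}:\ \alpha\ne\beta,\ \mathcal H^{k-1}(E_{\alpha\beta})\neq0}|U^\alpha-U^\beta|\,\mathcal H^{k-1}(E_{\alpha\beta}),$$ let $\partial TV_\Delta$ be its subdifferential in $H_\Delta$ and $\mathrm{Lip}(TV_\Delta)$ its Lipschitz constant on $H_\Delta$. Let $M$ be a compact, path-connected $C^2$ submanifold of $\mathbb R^\ell$ with tangential and normal projections $\pi_p,\pi_p^\perp$,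 second fundamental form $\mathrm{II}_p$ and exponential map $\exp_p$, where $s\mapsto\exp_p(sV)$ ($s\ge0$) is the geodesic in $M$ (solution of $\gamma''=\mathrm{II}_\gamma(\gamma',\gamma')$) with initial point $p$ and initial velocity $V$. Put $$\mathrm{Diam}(M)=\sup_{p,q\in M}|p-q|,\quad \mathrm{Curv}(M)=\sup_{p\in M,\,X\in T_pM}\frac{|\mathrm{II}_p(X,X)|}{|X|^2},\quad C_M=\sup_{p,q\in M}\frac{|\pi_p^\perp(p-q)|}{|p-q|^2}.$$ Let $M_\Delta\subset H_\Delta$ be the set of maps with values in $M$, let $T_uM_\Delta=\{X\in H_\Delta: X^\alpha\in T_{u^\alpha}M\ \text{for all }\alpha\}$, and let $P_u$ be the orthogonal projection onto $T_uM_\Delta$. Let $T>0$. *Discrete GK model.* $u\in W^{1,2}(0,T;M_\Delta)$ (continuous representative on $[0,T)$) is a solution with initial datum $u_0\in M_\Delta$ if $u(0)=u_0$ and $\frac{du}{dt}(t)\in -P_{u(t)}\partial TV_\Delta(u(t))$ for a.e. $t\in(0,T)$. *Scheme and Rothe interpolation.* Given $\tau>0$ and $u_0\in M_\Delta$, let $N$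 be the smallest integer greater than $T/\tau$, $t^{(n)}=n\tau$ for $n<N$, $t^{(N)}=T$. Set $u^{(0)}=u_0$ and, for $0\le n<N$, let $X^{(n)}$ minimize $\tau\,TV_\Delta(u^{(n)}+X)+\frac12\|X\|_{H_\Delta}^2$ over $X\in T_{u^{(n)}}M_\Delta$, and put $u^{(n+1)}=\exp_{u^{(n)}}(X^{(n)})$ (cellwise). The Rothe interpolation is $u_\tau(t)=\exp_{u^{(n)}}\big(\tfrac{t-t^{(n)}}{\tau}X^{(n)}\big)$ for $t\in[t^{(n)},t^{(n+1)})$. **Theorem.** Let $$C_0=4\,C_M\,\mathrm{Lip}(TV_\Delta)\,v(\Omega_\Delta)^{-1/2},$$ $$C_1=2\Big(2+\mathrm{Diam}(M)\,\mathcal L^k(\Omega)^{1/2}\,v(\Omega_\Delta)^{-1/2}\big(2C_M+\mathrm{Curv}(M)\big)\Big)\mathrm{Lip}(TV_\Delta)^2,$$ $$C_2=2\Big(\tfrac32\mathrm{Curv}(M)+C_M\Big)v(\Omega_\Delta)^{-1/2}\,\mathrm{Lip}(TV_\Delta)^3 .$$ Let $u_0^1,u_0^2\in M_\Delta$, let $u$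 be a solution of the discrete GK model with initial datum $u_0^1$, let $\tau>0$, and let $u_\tau$ be the Rothe interpolation of the scheme with step size $\tau$ started at $u_0^2$. Then for all $t\in[0,T)$ $$\|u_\tau(t)-u(t)\|_{H_\Delta}^2\le e^{C_0t}\|u_0^1-u_0^2\|_{H_\Delta}^2+t\,e^{C_0t}\,(C_1\tau+C_2\tau^2).$$ In particular, there is a constant $K$, depending only on $M$, $\Omega$, the partition and $T$, such that whenever $u_0^1=u_0^2$ and $0<\tau\le1$, $\|u_\tau(t)-u(t)\|_{H_\Delta}\le K\sqrt\tau$ for all $t\in[0,T)$. -/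

import Mathlib

open MeasureTheory Set

noncomputable section

/-- The Euclidean space `ℝⁿ`. -/
abbrev Euc (n : ℕ) : Type := EuclideanSpace ℝ (Fin n)

/-! ### Submanifolds of Euclidean space -/

/-- `M` is an (embedded, boundaryless) `C²` submanifold of `ℝ^ℓ`: near each of its points it is the
zero set of a `C²` submersion onto `ℝ^c`, where `c` is the codimension. -/
def IsC2Submanifold {l : ℕ} (M : Set (Euc l)) : Prop :=
  ∃ c : ℕ, ∀ p ∈ M, ∃ U : Set (Euc l), IsOpen U ∧ p ∈ U ∧ ∃ f : Euc l → Euc c,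
    ContDiffOn ℝ 2 f U ∧ (∀ x ∈ U, Function.Surjective (fderiv ℝ f x)) ∧
      M ∩ U = {x ∈ U | f x = 0}

/-- The tangent space `T_p M` (for a submanifold the tangent cone is already a linear subspace,
so that the span adds nothing). -/
def tangentSpaceAt {l : ℕ} (M : Set (Euc l)) (p : Euc l) : Submodule ℝ (Euc l) :=
  Submodule.span ℝ (tangentConeAt ℝ M p)

/-- The orthogonal projection `π_p` of `ℝ^ℓ` onto `T_p M`. -/
def tangentProj {l : ℕ} (M : Set (Euc l)) (p : Euc l) : Euc l →L[ℝ] Euc l :=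
  (tangentSpaceAt M p).starProjection

/-- The orthogonal projection `π_p^⊥` of `ℝ^ℓ` onto the normal space `(T_p M)^⊥`. -/
def normalProj {l : ℕ} (M : Set (Euc l)) (p : Euc l) : Euc l →L[ℝ] Euc l :=
  (tangentSpaceAt M p)ᗮ.starProjection

/-- The second fundamental form `II_p(X, Y) = π_p^⊥ (D_X Y)` for `X, Y ∈ T_p M`, computed with the
tangential extension `q ↦ π_q Y` of `Y` to `M`. The derivative along `M` in a direction `X` tangent
to `M` does not depend on the choice made by `fderivWithin`. -/
def secondFundForm {l : ℕ} (M : Set (Euc l)) (p X Y : Euc l) : Euc l :=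
  normalProj M p (fderivWithin ℝ (fun q => tangentProj M q Y) M p X)

/-- `Curv(M) = sup_{p ∈ M} sup_{X ∈ T_p M} ‖II_p(X, X)‖ / ‖X‖²`. -/
def curvBound {l : ℕ} (M : Set (Euc l)) : ℝ :=
  sSup {r : ℝ | ∃ p ∈ M, ∃ X ∈ tangentSpaceAt M p, r = ‖secondFundForm M p X X‖ / ‖X‖ ^ 2}

/-- `C_M = sup_{p, q ∈ M} ‖π_p^⊥ (p - q)‖ / ‖p - q‖²`. -/
def chordConst {l : ℕ} (M : Set (Euc l)) : ℝ :=
  sSup {r : ℝ | ∃ p ∈ M, ∃ q ∈ M, r = ‖normalProj M p (p - q)‖ / ‖p - q‖ ^ 2}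

/-- `γ : [0, ∞) → M` is the geodesic `γ^{p,V}` of `M` with initial point `p` and initial velocity
`V`: `γ'' = II_γ(γ', γ')`, `γ(0) = p`, `γ'(0) = V`. In terms of the exponential map,
`γ(s) = exp_p(s V)` for `s ≥ 0`. The values of `γ` on `(-∞, 0)` are irrelevant. -/
def IsGeodesic {l : ℕ} (M : Set (Euc l)) (p V : Euc l) (γ : ℝ → Euc l) : Prop :=
  γ 0 = p ∧ (∀ s ∈ Ici (0 : ℝ), γ s ∈ M) ∧
    ∃ γ' : ℝ → Euc l, γ' 0 = V ∧
      (∀ s ∈ Ici (0 : ℝ), HasDerivWithinAt γ (γ' s) (Ici 0) s) ∧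
      ∀ s ∈ Ici (0 : ℝ), HasDerivWithinAt γ' (secondFundForm M (γ s) (γ' s) (γ' s)) (Ici 0) s

/-! ### Rectangular partitions and piecewise constant maps -/

/-- `(Ω_α)_{α ∈ Δ}` is a rectangular partition of `Ω ⊆ ℝ^k` into nonempty cells. -/
structure IsRectPartition {k : ℕ} {Δ : Type*} (Ω : Set (Euc k)) (cell : Δ → Set (Euc k)) :
    Prop where
  cover : volume (Ω \ ⋃ α, cell α) = 0
  disj : ∀ α β, α ≠ β → volume (cell α ∩ cell β) = 0
  box : ∀ α, ∃ a b : Fin k → ℝ, (∀ j, a j < b j) ∧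
    cell α = {x | ∀ j, a j < x j ∧ x j < b j} ∩ Ω
  nonempty : ∀ α, (cell α).Nonempty

/-- `v(Ω_Δ) = inf_α L^k(Ω_α)`. -/
def minVol {k : ℕ} {Δ : Type*} (cell : Δ → Set (Euc k)) : ℝ :=
  ⨅ α, (volume (cell α)).toReal

/-- The `d`-dimensional Hausdorff measure of a set, with the usual normalization (under which it
agrees with Lebesgue measure on `d`-dimensional planes); Mathlib's `μH[d]` is not normalized. -/
def hausdorffNormalized {k : ℕ} (d : ℕ) (s : Set (Euc k)) : ENNReal :=
  volume (Metric.ball (0 : Euc d) 1) / 2 ^ d * Measure.hausdorffMeasure (d : ℝ) s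

/-- `H^{k-1}(E_γ)` with `E_γ = closure (∂Ω_α ∩ ∂Ω_β)` for the unordered pair `γ = {α, β}`. -/
def edgeMeasure {k : ℕ} {Δ : Type*} (cell : Δ → Set (Euc k)) : Sym2 Δ → ENNReal :=
  Sym2.lift ⟨fun α β => hausdorffNormalized (k - 1)
    (closure (frontier (cell α) ∩ frontier (cell β))), fun α β => by
      simp only [inter_comm (frontier (cell α))]⟩

/-- The set `e(Δ)` of edges: pairs `{α, β}` with `α ≠ β` and `H^{k-1}(E_γ) ≠ 0`. -/
def edgeSet {k : ℕ} {Δ : Type*} (cell : Δ → Set (Euc k)) : Set (Sym2 Δ) :=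
  {γ | ¬ γ.IsDiag ∧ edgeMeasure cell γ ≠ 0}

/-- Elements of `H_Δ` are represented by their values `U^α` on the cells, `U : Δ → ℝ^ℓ`; this is the
associated piecewise constant map `∑_α U^α 1_{Ω_α}` on `ℝ^k`. -/
def stepFun {k l : ℕ} {Δ : Type*} [Fintype Δ] (cell : Δ → Set (Euc k)) (U : Δ → Euc l) :
    Euc k → Euc l :=
  fun x => ∑ α, (cell α).indicator (fun _ => U α) x

/-- The inner product of `H_Δ`, i.e. the one of `L²(Ω; ℝ^ℓ)`. -/
def hInner {k l : ℕ} {Δ : Type*} [Fintype Δ] (Ω : Set (Euc k)) (cell : Δ → Set (Euc k))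
    (U V : Δ → Euc l) : ℝ :=
  ∫ x in Ω, inner ℝ (stepFun cell U x) (stepFun cell V x)

/-- The norm of `H_Δ`, i.e. the one of `L²(Ω; ℝ^ℓ)`. -/
def hNorm {k l : ℕ} {Δ : Type*} [Fintype Δ] (Ω : Set (Euc k)) (cell : Δ → Set (Euc k))
    (U : Δ → Euc l) : ℝ :=
  Real.sqrt (∫ x in Ω, ‖stepFun cell U x‖ ^ 2)

/-- The discrete total variation `TV_Δ(U) = ∑_{γ = {α, β} ∈ e(Δ)} ‖U^α - U^β‖ H^{k-1}(E_γ)`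
(the orientation of the edges does not affect the norm of the jump). -/
def discreteTV {k l : ℕ} {Δ : Type*} [Fintype Δ] (cell : Δ → Set (Euc k)) (U : Δ → Euc l) : ℝ :=
  open Classical in
  ∑ γ : Sym2 Δ, if γ ∈ edgeSet cell then
    Sym2.lift ⟨fun α β => ‖U α - U β‖, fun α β => norm_sub_rev (U α) (U β)⟩ γ
      * (edgeMeasure cell γ).toReal else 0

/-- `Lip(TV_Δ)`, with respect to the norm of `H_Δ`. -/
def lipTV {k : ℕ} {Δ : Type*} [Fintype Δ] (l : ℕ) (Ω : Set (Euc k))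
    (cell : Δ → Set (Euc k)) : ℝ :=
  sSup {r : ℝ | ∃ U V : Δ → Euc l,
    r = |discreteTV cell U - discreteTV cell V| / hNorm Ω cell (U - V)}

/-- The subdifferential `∂TV_Δ(U)` in `H_Δ`. -/
def subdiffTV {k l : ℕ} {Δ : Type*} [Fintype Δ] (Ω : Set (Euc k)) (cell : Δ → Set (Euc k))
    (U : Δ → Euc l) : Set (Δ → Euc l) :=
  {ζ | ∀ V : Δ → Euc l, hInner Ω cell ζ (V - U) + discreteTV cell U ≤ discreteTV cell V}

/-- The set `M_Δ` of piecewise constant maps with values in `M`. -/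
def mapsInto {l : ℕ} {Δ : Type*} (M : Set (Euc l)) : Set (Δ → Euc l) :=
  {u | ∀ α, u α ∈ M}

/-- The tangent space `T_u M_Δ`. -/
def tangentMaps {l : ℕ} {Δ : Type*} (M : Set (Euc l)) (u : Δ → Euc l) : Set (Δ → Euc l) :=
  {X | ∀ α, X α ∈ tangentSpaceAt M (u α)}

/-- The orthogonal projection `P_u : H_Δ → T_u M_Δ`, acting pointwise. -/
def projMaps {l : ℕ} {Δ : Type*} (M : Set (Euc l)) (u X : Δ → Euc l) : Δ → Euc l :=
  fun α => tangentProj M (u α) (X α)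

/-! ### The discrete Giga-Kobayashi model -/

/-- `u ∈ W^{1,2}(0,T; M_Δ)` solves the discrete Giga-Kobayashi model with initial datum `u₀`:
`u` is an `M_Δ`-valued primitive of some `g = du/dt ∈ L²(0,T; H_Δ)` with `u(0) = u₀` and
`g(t) ∈ -P_{u(t)} ∂TV_Δ(u(t))` for a.e. `t`. -/
def IsGKSolution {k l : ℕ} {Δ : Type*} [Fintype Δ] (M : Set (Euc l)) (Ω : Set (Euc k))
    (cell : Δ → Set (Euc k)) (T : ℝ) (u₀ : Δ → Euc l) (u : ℝ → Δ → Euc l) : Prop :=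
  (∀ t ∈ Ico 0 T, u t ∈ mapsInto M) ∧
    ∃ g : ℝ → Δ → Euc l, MemLp g 2 (volume.restrict (Ioo 0 T)) ∧
      (∀ t ∈ Ico 0 T, u t = u₀ + ∫ s in (0 : ℝ)..t, g s) ∧
      ∀ᵐ t ∂(volume.restrict (Ioo 0 T)),
        ∃ ζ ∈ subdiffTV Ω cell (u t), g t = -projMaps M (u t) ζ

/-! ### The modified minimizing movement scheme and its Rothe interpolation -/

/-- The localized energy `Φ_loc^τ(X; u) = τ TV_Δ(u + X) + ½ ‖X‖²`. -/
def localEnergy {k l : ℕ} {Δ : Type*} [Fintype Δ] (Ω : Set (Euc k)) (cell : Δ → Set (Euc k))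
    (τ : ℝ) (u X : Δ → Euc l) : ℝ :=
  τ * discreteTV cell (u + X) + 1 / 2 * hNorm Ω cell X ^ 2

/-- The number of steps: the minimal integer greater than `T / τ`. -/
def numSteps (T τ : ℝ) : ℕ := ⌊T / τ⌋₊ + 1

/-- The time nodes: `t⁽ⁿ⁾ = n τ` for `n < N` and `t⁽ᴺ⁾ = T`. -/
def timeNode (T τ : ℝ) (n : ℕ) : ℝ := if n < numSteps T τ then n * τ else T

/-- `uτ` is the Rothe interpolation on `[0, T)` of a sequence generated by the modified minimizing
movement scheme with step size `τ` started at `u₀`: `X⁽ⁿ⁾` minimizes the localized energy over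
`T_{u⁽ⁿ⁾} M_Δ`, `u⁽ⁿ⁺¹⁾ = Exp_{u⁽ⁿ⁾}(X⁽ⁿ⁾)`, and
`uτ(t) = Exp_{u⁽ⁿ⁾}(((t - t⁽ⁿ⁾)/τ) X⁽ⁿ⁾)` for `t⁽ⁿ⁾ ≤ t < t⁽ⁿ⁺¹⁾`. The exponential map acts
cellwise, and `s ↦ exp_p(s V)` is the geodesic with initial point `p` and initial velocity `V`. -/
def IsRotheInterpolation {k l : ℕ} {Δ : Type*} [Fintype Δ] (M : Set (Euc l)) (Ω : Set (Euc k))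
    (cell : Δ → Set (Euc k)) (T τ : ℝ) (u₀ : Δ → Euc l) (uτ : ℝ → Δ → Euc l) : Prop :=
  ∃ (u X : ℕ → Δ → Euc l) (γ : ℕ → Δ → ℝ → Euc l),
    u 0 = u₀ ∧
    ∀ n < numSteps T τ,
      X n ∈ tangentMaps M (u n) ∧
      IsMinOn (localEnergy Ω cell τ (u n)) (tangentMaps M (u n)) (X n) ∧
      (∀ α, IsGeodesic M (u n α) (X n α) (γ n α)) ∧
      (∀ α, u (n + 1) α = γ n α 1) ∧
      ∀ t ∈ Ico (timeNode T τ n) (timeNode T τ (n + 1)),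
        ∀ α, uτ t α = γ n α ((t - timeNode T τ n) / τ)

/-! ### The constants of the error estimate -/

/-- `C₀ = 4 C_M Lip(TV_Δ) v(Ω_Δ)^{-1/2}`. -/
def errC0 {k l : ℕ} {Δ : Type*} [Fintype Δ] (M : Set (Euc l)) (Ω : Set (Euc k))
    (cell : Δ → Set (Euc k)) : ℝ :=
  4 * chordConst M * lipTV l Ω cell * minVol cell ^ (-(1 / 2) : ℝ)

/-- `C₁ = 2 (2 + Diam(M) L^k(Ω)^{1/2} v(Ω_Δ)^{-1/2} (2 C_M + Curv(M))) Lip(TV_Δ)²`. -/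
def errC1 {k l : ℕ} {Δ : Type*} [Fintype Δ] (M : Set (Euc l)) (Ω : Set (Euc k))
    (cell : Δ → Set (Euc k)) : ℝ :=
  2 * (2 + Metric.diam M * (volume Ω).toReal ^ (1 / 2 : ℝ) * minVol cell ^ (-(1 / 2) : ℝ)
    * (2 * chordConst M + curvBound M)) * lipTV l Ω cell ^ 2

/-- `C₂ = 2 (3/2 Curv(M) + C_M) v(Ω_Δ)^{-1/2} Lip(TV_Δ)³`. -/
def errC2 {k l : ℕ} {Δ : Type*} [Fintype Δ] (M : Set (Euc l)) (Ω : Set (Euc k))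
    (cell : Δ → Set (Euc k)) : ℝ :=
  2 * (3 / 2 * curvBound M + chordConst M) * minVol cell ^ (-(1 / 2) : ℝ) * lipTV l Ω cell ^ 3

end

noncomputable section

open Filter Topology

/-! ### Tangent cones of level sets, stability of surjectivity, and derivatives along tangent
directions -/

section LevelSets

variable {E F : Type*} [NormedAddCommGroup E] [NormedSpace ℝ E] [NormedAddCommGroup F]
  [NormedSpace ℝ F]

/-! The argument is the energy estimate for the implicit Euler scheme of a convex gradient flow,
with the curvature of $M$ entering as quadratic errors. Let $w$ be a Rothe arc issuing from $p$ with
minimizer $X$, and let $u' = -P_u\zeta$ with $\zeta\in\partial TV_\Delta(u)$. Differentiating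
$\|w-u\|^2$ produces $\langle P_u\zeta, w-u\rangle$, $\tau^{-1}\langle X, p+X-u\rangle$ and
remainders.

In the first term $P_u$ moves onto $w-u$, a chord of $M$ that is tangent at $u$ up to $C_M|w-u|^2$
on each cell; convexity leaves $TV_\Delta(w)-TV_\Delta(u)$ plus a quadratic error
(`inner_projMaps_subdiffTV_le`). In the second, the variational inequality for $X$, tested with
$P_p(u-p)$, leaves $TV_\Delta(u)-TV_\Delta(p+X)$ plus an error quadratic in $u-p$
(`inner_minimizer_le`). The terms $TV_\Delta(u)$ cancel, and $TV_\Delta(w)-TV_\Delta(p+X)$ is at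
most the Lipschitz constant times $\|w-(p+X)\|$. This distance is of order $\tau$, since
$\|X\|\le\tau\,\mathrm{Lip}(TV_\Delta)$ and $w$ follows geodesics of constant speed
(`IsGeodesic.exists_velocity`).

Altogether $\frac{d}{dt}\|w-u\|^2\le C_0\|w-u\|^2+C_1\tau+C_2\tau^2$
(`two_mul_inner_velocity_sub_le`). Gronwall's inequality is used as monotonicity of
$e^{-C_0t}\|w-u\|^2-(C_1\tau+C_2\tau^2)t$, which passes from step to step without loss.

The factors $v(\Omega_\Delta)^{-1/2}$ come from turning cellwise quadratic bounds into $L^2$ bounds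
(`norm_hEmb_le_of_sq`). A real `sSup` is $0$ on an unbounded set, so the constants bound anything
only once their finiteness is known: for $\mathrm{Curv}(M)$ and $C_M$ by compactness and the
Lipschitz dependence of $T_pM$ on $p$ (`IsC2Submanifold.exists_local_bounds`), for
$\mathrm{Lip}(TV_\Delta)$ by finite dimension. -/

theorem tangentConeAt_subset_ker {f : E → F} {A : E →L[ℝ] F} {M : Set E} {p : E}
    (hf : HasFDerivAt f A p) (hp : f p = 0) (h0 : ∀ᶠ x in 𝓝[M] p, f x = 0) {v : E}
    (hv : v ∈ tangentConeAt ℝ M p) : A v = 0 := by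
  have h1 : HasFDerivWithinAt f (0 : E →L[ℝ] F) M p :=
    (hasFDerivWithinAt_const (0 : F) p M).congr_of_eventuallyEq h0 hp
  simpa using hf.hasFDerivWithinAt.unique_on h1 hv

/-- The implicit function theorem provides a curve in the level set through `p` with velocity `v`;
it carries the tangent direction `1` of the parameter line to `v`. -/
theorem mem_tangentConeAt_of_ker [CompleteSpace E] [FiniteDimensional ℝ F]
    {f : E → F} {A : E →L[ℝ] F} {M : Set E} {p : E} (hf : HasStrictFDerivAt f A p)
    (hA : Function.Surjective A) (hp : f p = 0) (h0 : ∀ᶠ x in 𝓝 p, f x = 0 → x ∈ M) {v : E}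
    (hv : A v = 0) : v ∈ tangentConeAt ℝ M p := by
  have hr : (A : E →ₗ[ℝ] F).range = ⊤ := LinearMap.range_eq_top.2 hA
  let k : (A : E →ₗ[ℝ] F).ker := ⟨v, hv⟩
  let φ : ℝ → E := fun t => hf.implicitFunction f A hr (f p) (t • k)
  have hφ0 : φ 0 = p := by
    simp only [φ, zero_smul]
    exact hf.implicitFunction_apply_image hr
  have hlin : HasFDerivAt (fun t : ℝ => t • k) (ContinuousLinearMap.toSpanSingleton ℝ k) 0 :=
    (ContinuousLinearMap.toSpanSingleton ℝ k).hasFDerivAt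
  have hφ : HasFDerivAt φ ((A : E →ₗ[ℝ] F).ker.subtypeL ∘L
      ContinuousLinearMap.toSpanSingleton ℝ k) 0 := by
    have h := (hf.to_implicitFunction hr).hasFDerivAt
    rw [← zero_smul ℝ k] at h
    exact HasFDerivAt.comp (0 : ℝ) h hlin
  have hcont : Tendsto (fun t : ℝ => (f p, t • k)) (𝓝 0) (𝓝 (f p, 0)) := by
    have : Continuous (fun t : ℝ => (f p, t • k)) := by fun_prop
    simpa using this.tendsto 0
  have hzero : ∀ᶠ t in 𝓝 (0 : ℝ), f (φ t) = 0 := by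
    filter_upwards [hcont.eventually (hf.map_implicitFunction_eq hr)] with t ht
    rw [← hp]
    exact ht
  have hM : ∀ᶠ t in 𝓝 (0 : ℝ), φ t ∈ M := by
    have hc : Tendsto φ (𝓝 0) (𝓝 p) := by
      have := hφ.continuousAt.tendsto
      rwa [hφ0] at this
    filter_upwards [hc.eventually h0, hzero] with t h1 h2 using h1 h2
  have hs : (1 : ℝ) ∈ tangentConeAt ℝ {t | φ t ∈ M} 0 := by
    rw [tangentConeAt_of_mem_nhds hM]
    trivial
  have := (hφ.hasFDerivWithinAt (s := {t | φ t ∈ M})).mapsTo_tangent_cone hs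
  have h2 := tangentConeAt_mono (𝕜 := ℝ) (x := φ 0) (image_subset_iff.2 (fun t ht => ht) :
    φ '' {t | φ t ∈ M} ⊆ M) this
  rw [hφ0] at h2
  simpa [k] using h2

/-- If `R` is a right inverse of `A₀`, then `A ∘ R` is close to the identity, hence injective, hence
surjective in finite dimension. Uniformity in `A` is what later gives local constants. -/
theorem exists_bounded_preimage_near [FiniteDimensional ℝ F] (A₀ : E →L[ℝ] F)
    (hA : Function.Surjective A₀) :
    ∃ K > 0, ∃ ε > 0, ∀ A : E →L[ℝ] F, ‖A - A₀‖ ≤ ε → ∀ y, ∃ x, A x = y ∧ ‖x‖ ≤ K * ‖y‖ := by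
  obtain ⟨R, hR⟩ := A₀.exists_rightInverse_of_surjective (LinearMap.range_eq_top.2 hA)
  refine ⟨2 * (‖R‖ + 1), by positivity, 1 / (2 * (‖R‖ + 1)), by positivity, fun A hAA y => ?_⟩
  have hR' : ∀ z, A₀ (R z) = z := fun z => by
    simpa using congrArg (fun B : F →L[ℝ] F => B z) hR
  have key : ∀ z, ‖z‖ ≤ 2 * ‖A (R z)‖ := fun z => by
    have h1 : ‖A (R z) - z‖ ≤ 1 / 2 * ‖z‖ := by
      have : A (R z) - z = (A - A₀) (R z) := by simp [hR']
      rw [this]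
      calc ‖(A - A₀) (R z)‖ ≤ ‖A - A₀‖ * (‖R‖ * ‖z‖) :=
            (A - A₀).le_opNorm_of_le (R.le_opNorm z)
        _ ≤ 1 / (2 * (‖R‖ + 1)) * ((‖R‖ + 1) * ‖z‖) := by gcongr; linarith
        _ = 1 / 2 * ‖z‖ := by field_simp
    have h2 : ‖z‖ ≤ ‖A (R z)‖ + ‖A (R z) - z‖ := by
      have := norm_sub_le (A (R z)) (A (R z) - z)
      simpa using this
    linarith
  have hinj : Function.Injective ((A : E →ₗ[ℝ] F) ∘ₗ (R : F →ₗ[ℝ] E)) := by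
    rw [injective_iff_map_eq_zero]
    intro z hz
    have := key z
    have hz' : A (R z) = 0 := hz
    rw [hz', norm_zero, mul_zero] at this
    exact norm_le_zero_iff.1 this
  obtain ⟨z, hz⟩ := (LinearMap.injective_iff_surjective.1 hinj) y
  have hz' : A (R z) = y := hz
  refine ⟨R z, hz', ?_⟩
  have h1 := key z
  rw [hz'] at h1
  calc ‖R z‖ ≤ ‖R‖ * ‖z‖ := R.le_opNorm z
    _ ≤ (‖R‖ + 1) * (2 * ‖y‖) := by gcongr; linarith
    _ = _ := by ring

/-- Along a sequence realizing `v`, the derivative is a limit of difference quotients, whichever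
derivative `fderivWithin` selects. Without differentiability its default value is `0`, so the bound
needs no smoothness hypothesis. -/
theorem norm_fderivWithin_apply_le_of_mem_tangentConeAt {f : E → F} {M : Set E} {p : E} {L : ℝ}
    (hL : ∀ᶠ x in 𝓝[M] p, ‖f x - f p‖ ≤ L * ‖x - p‖) (hL0 : 0 ≤ L) {v : E}
    (hv : v ∈ tangentConeAt ℝ M p) : ‖fderivWithin ℝ f M p v‖ ≤ L * ‖v‖ := by
  by_cases hd : DifferentiableWithinAt ℝ f M p
  · obtain ⟨c, d, hd0, hdM, hcd⟩ := mem_tangentConeAt_iff_exists_seq.1 hv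
    have h1 := hd.hasFDerivWithinAt.lim hd0 hdM hcd
    refine le_of_tendsto_of_tendsto h1.norm (hcd.norm.const_mul L) ?_
    have h2 : Tendsto (fun n => p + d n) atTop (𝓝[M] p) := by
      refine tendsto_nhdsWithin_iff.2 ⟨?_, hdM⟩
      simpa using hd0.const_add p
    filter_upwards [h2.eventually hL] with n hn
    rw [norm_smul, norm_smul]
    rw [add_sub_cancel_left] at hn
    calc ‖c n‖ * ‖f (p + d n) - f p‖ ≤ ‖c n‖ * (L * ‖d n‖) := by gcongr
      _ = _ := by ring
  · rw [fderivWithin_zero_of_not_differentiableWithinAt hd]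
    simpa using by positivity

end LevelSets

/-! ### Chord, curvature and geodesic estimates on a compact C² submanifold -/

section Submanifold

variable {l : ℕ}

theorem norm_normalProj_apply_le (M : Set (Euc l)) (p v : Euc l) : ‖normalProj M p v‖ ≤ ‖v‖ :=
  Submodule.norm_starProjection_apply_le _ v

theorem tangentProj_add_normalProj (M : Set (Euc l)) (p v : Euc l) :
    tangentProj M p v + normalProj M p v = v :=
  Submodule.starProjection_add_starProjection_orthogonal v

theorem normalProj_eq_zero {M : Set (Euc l)} {p v : Euc l} (hv : v ∈ tangentSpaceAt M p) :
    normalProj M p v = 0 := by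
  rw [normalProj, Submodule.starProjection_orthogonal_val,
    Submodule.starProjection_eq_self_iff.2 hv, sub_self]

theorem tangentProj_mem (M : Set (Euc l)) (p v : Euc l) :
    tangentProj M p v ∈ tangentSpaceAt M p :=
  Submodule.starProjection_apply_mem _ v

theorem inner_normalProj_eq_zero {M : Set (Euc l)} {p X : Euc l} (hX : X ∈ tangentSpaceAt M p)
    (v : Euc l) : inner ℝ X (normalProj M p v) = 0 :=
  Submodule.inner_right_of_mem_orthogonal hX (Submodule.starProjection_apply_mem _ v)

theorem inner_tangentProj_left (M : Set (Euc l)) (p v w : Euc l) :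
    inner ℝ (tangentProj M p v) w = inner ℝ v (tangentProj M p w) :=
  Submodule.inner_starProjection_left_eq_right _ v w

/-- Near each point, a `C²` submanifold is described by a Lipschitz field of surjective linear maps
whose kernels are the tangent spaces. -/
theorem IsC2Submanifold.exists_local_conormal {M : Set (Euc l)} (hM : IsC2Submanifold M)
    {p₀ : Euc l} (hp₀ : p₀ ∈ M) :
    ∃ (c : ℕ) (A : Euc l → Euc l →L[ℝ] Euc c) (K : ℝ) (V : Set (Euc l)), 0 ≤ K ∧ V ∈ 𝓝 p₀ ∧
      (∀ p ∈ M ∩ V, ∀ v, A p v = 0 → v ∈ tangentConeAt ℝ M p) ∧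
      (∀ p ∈ M ∩ V, ∀ v ∈ tangentSpaceAt M p, A p v = 0) ∧
      (∀ p ∈ V, ∀ q ∈ V, ‖A q - A p‖ ≤ K * ‖q - p‖) ∧
      (∀ p ∈ M ∩ V, ∀ q ∈ M ∩ V, ‖A p (q - p)‖ ≤ K * ‖q - p‖ ^ 2) ∧
      ∀ p ∈ V, ∀ y, ∃ x, A p x = y ∧ ‖x‖ ≤ K * ‖y‖ := by
  obtain ⟨c, hc⟩ := hM
  obtain ⟨U, hU, hpU, f, hf, hsurj, hMU⟩ := hc p₀ hp₀
  have hCD : ∀ x ∈ U, ContDiffAt ℝ 2 f x := fun x hx => hf.contDiffAt (hU.mem_nhds hx)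
  obtain ⟨L, t, ht, hLt⟩ := ((hCD p₀ hpU).fderiv_right (m := 1)
    (by norm_num)).exists_lipschitzOnWith
  obtain ⟨K, hK, ε, hε, hpre⟩ := exists_bounded_preimage_near _ (hsurj p₀ hpU)
  have hcont : ∀ᶠ x in 𝓝 p₀, ‖fderiv ℝ f x - fderiv ℝ f p₀‖ ≤ ε := by
    have h1 := ((hCD p₀ hpU).fderiv_right (m := 1) (by norm_num)).continuousAt
    have := Metric.continuousAt_iff'.1 h1 ε hε
    filter_upwards [this] with x hx
    rw [← dist_eq_norm]
    exact hx.le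
  obtain ⟨r, hr, hball⟩ := Metric.mem_nhds_iff.1
    (inter_mem (inter_mem (hU.mem_nhds hpU) ht) hcont)
  have hzero : ∀ p ∈ M ∩ Metric.ball p₀ r, f p = 0 := fun p hp => by
    have : p ∈ M ∩ U := ⟨hp.1, (hball hp.2).1.1⟩
    rw [hMU] at this
    exact this.2
  have hlip : ∀ p ∈ Metric.ball p₀ r, ∀ q ∈ Metric.ball p₀ r,
      ‖fderiv ℝ f q - fderiv ℝ f p‖ ≤ L * ‖q - p‖ := fun p hp q hq => by
    simpa [dist_eq_norm] using hLt.dist_le_mul q (hball hq).1.2 p (hball hp).1.2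
  refine ⟨c, fderiv ℝ f, max L K, Metric.ball p₀ r, by positivity, Metric.ball_mem_nhds _ hr,
    ?_, ?_, ?_, ?_, ?_⟩
  · intro p hp v hv
    have hpU' := (hball hp.2).1.1
    refine mem_tangentConeAt_of_ker ((hCD p hpU').hasStrictFDerivAt (by norm_num)) (hsurj p hpU')
      (hzero p hp) ?_ hv
    filter_upwards [hU.mem_nhds hpU'] with x hx hx0
    have : x ∈ M ∩ U := by rw [hMU]; exact ⟨hx, hx0⟩
    exact this.1
  · intro p hp v hv
    have hpU' := (hball hp.2).1.1
    have hle : tangentSpaceAt M p ≤ LinearMap.ker (fderiv ℝ f p : Euc l →ₗ[ℝ] Euc c) := by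
      refine Submodule.span_le.2 fun w hw => ?_
      refine tangentConeAt_subset_ker
        ((hCD p hpU').differentiableAt (by norm_num)).hasFDerivAt (hzero p hp) ?_ hw
      filter_upwards [nhdsWithin_le_nhds (hU.mem_nhds hpU'), self_mem_nhdsWithin] with x hx hxM
      have : x ∈ M ∩ U := ⟨hxM, hx⟩
      rw [hMU] at this
      exact this.2
    exact hle hv
  · intro p hp q hq
    exact (hlip p hp q hq).trans (by gcongr; exact le_max_left _ _)
  -- Both points are zeros of `f`, so `A p (q - p)` is minus the first order Taylor remainder, which
  -- is quadratic because the derivative is Lipschitz.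
  · intro p hp q hq
    have hseg : segment ℝ p q ⊆ Metric.ball p₀ r :=
      (convex_ball p₀ r).segment_subset hp.2 hq.2
    have := Convex.norm_image_sub_le_of_norm_hasFDerivWithin_le' (f := f) (f' := fderiv ℝ f)
      (s := segment ℝ p q) (C := L * ‖q - p‖) (φ := fderiv ℝ f p) (x := p) (y := q)
      (fun x hx => ((hCD x (hball (hseg hx)).1.1).differentiableAt
        (by norm_num)).hasFDerivAt.hasFDerivWithinAt)
      (fun x hx => (hlip p hp.2 x (hseg hx)).trans (by
        gcongr
        exact norm_sub_le_of_mem_segment hx))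
      (convex_segment p q) (left_mem_segment ℝ p q) (right_mem_segment ℝ p q)
    rw [hzero p hp, hzero q hq, sub_zero, zero_sub, norm_neg] at this
    calc _ ≤ L * ‖q - p‖ ^ 2 := by rw [pow_two, ← mul_assoc]; exact this
      _ ≤ _ := by gcongr; exact le_max_left _ _
  · intro p hp y
    obtain ⟨x, hx, hxy⟩ := hpre _ (hball hp).2 y
    exact ⟨x, hx, hxy.trans (by gcongr; exact le_max_right _ _)⟩

/-- The normal part of `v` is controlled by `A p v`, since `v` differs from a bounded preimage of `A
p v` by a tangent vector. Both estimates then follow from the conormal field `A`; the second uses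
$\pi_q-\pi_p=\pi_q\pi_p^\perp-\pi_q^\perp\pi_p$. -/
theorem IsC2Submanifold.exists_local_bounds {M : Set (Euc l)} (hM : IsC2Submanifold M)
    {p₀ : Euc l} (hp₀ : p₀ ∈ M) :
    ∃ (C : ℝ) (V : Set (Euc l)), 0 ≤ C ∧ V ∈ 𝓝 p₀ ∧
      (∀ p ∈ M ∩ V, ∀ v ∈ tangentSpaceAt M p, v ∈ tangentConeAt ℝ M p) ∧
      (∀ p ∈ M ∩ V, ∀ q ∈ M ∩ V, ‖normalProj M p (p - q)‖ ≤ C * ‖p - q‖ ^ 2) ∧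
      ∀ p ∈ M ∩ V, ∀ q ∈ M ∩ V, ‖tangentProj M q - tangentProj M p‖ ≤ C * ‖q - p‖ := by
  obtain ⟨c, A, K, V, hK, hV, hker, htan, hlip, hchord, hpre⟩ := hM.exists_local_conormal hp₀
  have hnormal : ∀ p ∈ M ∩ V, ∀ v, ‖normalProj M p v‖ ≤ K * ‖A p v‖ := fun p hp v => by
    obtain ⟨x, hx, hxv⟩ := hpre p hp.2 (A p v)
    have h0 : normalProj M p (v - x) = 0 :=
      normalProj_eq_zero (Submodule.subset_span (hker p hp _ (by rw [map_sub, hx, sub_self])))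
    rw [map_sub, sub_eq_zero] at h0
    rw [h0]
    exact (norm_normalProj_apply_le M p x).trans hxv
  have hcross : ∀ p ∈ M ∩ V, ∀ q ∈ M ∩ V, ∀ v,
      ‖normalProj M q (tangentProj M p v)‖ ≤ K * (K * ‖q - p‖) * ‖v‖ := fun p hp q hq v => by
    have h0 := htan p hp _ (tangentProj_mem M p v)
    have h1 : A q (tangentProj M p v) = (A q - A p) (tangentProj M p v) := by
      simp [h0]
    calc _ ≤ K * ‖A q (tangentProj M p v)‖ := hnormal q hq _
      _ ≤ K * (K * ‖q - p‖ * ‖v‖) := by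
        gcongr
        rw [h1]
        refine ((A q - A p).le_opNorm _).trans ?_
        gcongr
        · exact hlip p hp.2 q hq.2
        · exact Submodule.norm_starProjection_apply_le _ v
      _ = _ := by ring
  -- $\pi_q\pi_p^\perp$ is the adjoint of $\pi_p^\perp\pi_q$, so this is the previous bound with `p`
  -- and `q` exchanged.
  have hcross' : ∀ p ∈ M ∩ V, ∀ q ∈ M ∩ V, ∀ v,
      ‖tangentProj M q (normalProj M p v)‖ ≤ K * (K * ‖q - p‖) * ‖v‖ := fun p hp q hq v => by
    set w := tangentProj M q (normalProj M p v) with hw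
    have h1 : ‖w‖ ^ 2 = inner ℝ v (normalProj M p (tangentProj M q w)) := by
      have hww : tangentProj M q w = w :=
        Submodule.starProjection_eq_self_iff.2 (tangentProj_mem M q _)
      rw [hww, ← real_inner_self_eq_norm_sq, hw, inner_tangentProj_left, ← hw, hww,
        normalProj, Submodule.inner_starProjection_left_eq_right]
    have h2 : ‖w‖ ^ 2 ≤ ‖v‖ * (K * (K * ‖q - p‖) * ‖w‖) := by
      rw [h1]
      refine (real_inner_le_norm _ _).trans ?_
      gcongr
      rw [norm_sub_rev]
      exact hcross q hq p hp w
    rcases (norm_nonneg w).eq_or_lt with h | h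
    · rw [← h]; positivity
    · nlinarith
  refine ⟨2 * (K * K), V, by positivity, hV, ?_, ?_, ?_⟩
  · exact fun p hp v hv => hker p hp v (htan p hp v hv)
  · intro p hp q hq
    calc _ ≤ K * ‖A p (p - q)‖ := hnormal p hp _
      _ = K * ‖A p (q - p)‖ := by rw [← norm_neg (A p (p - q)), ← map_neg, neg_sub]
      _ ≤ K * (K * ‖q - p‖ ^ 2) := by gcongr; exact hchord p hp q hq
      _ ≤ _ := by
        rw [norm_sub_rev q p]
        nlinarith [mul_nonneg (mul_nonneg hK hK) (sq_nonneg ‖p - q‖)]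
  · intro p hp q hq
    refine ContinuousLinearMap.opNorm_le_bound _ (by positivity) fun v => ?_
    have h1 : (tangentProj M q - tangentProj M p) v
        = tangentProj M q (normalProj M p v) - normalProj M q (tangentProj M p v) := by
      have e1 := congrArg (tangentProj M q) (tangentProj_add_normalProj M p v)
      have e2 := tangentProj_add_normalProj M q (tangentProj M p v)
      rw [map_add] at e1
      rw [sub_apply, ← e1]
      nth_rewrite 2 [← e2]
      abel
    rw [h1]
    refine (norm_sub_le _ _).trans ?_
    have := hcross p hp q hq v
    have := hcross' p hp q hq v
    linarith

theorem secondFundForm_mem_normal (M : Set (Euc l)) {p X : Euc l} (Y : Euc l)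
    (hX : X ∈ tangentSpaceAt M p) : inner ℝ X (secondFundForm M p Y Y) = 0 :=
  inner_normalProj_eq_zero hX _

/-- Locally $q\mapsto\pi_q$ is Lipschitz along $M$, which bounds its derivative in tangent
directions; compactness makes the bound global. -/
theorem curvSet_bddAbove {M : Set (Euc l)} (hM : IsC2Submanifold M) (hMc : IsCompact M) :
    BddAbove {r : ℝ | ∃ p ∈ M, ∃ X ∈ tangentSpaceAt M p,
      r = ‖secondFundForm M p X X‖ / ‖X‖ ^ 2} := by
  suffices h : ∃ C : ℝ, ∀ p ∈ M, ∀ X ∈ tangentSpaceAt M p,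
      ‖secondFundForm M p X X‖ / ‖X‖ ^ 2 ≤ C by
    obtain ⟨C, hC⟩ := h
    refine ⟨C, ?_⟩
    rintro r ⟨p, hp, X, hX, rfl⟩
    exact hC p hp X hX
  refine hMc.induction_on (p := fun s => ∃ C : ℝ, ∀ p ∈ s, p ∈ M → ∀ X ∈ tangentSpaceAt M p,
      ‖secondFundForm M p X X‖ / ‖X‖ ^ 2 ≤ C) ⟨0, by simp⟩ ?_ ?_ ?_ |>.imp
      fun C hC p hp => hC p hp hp
  · rintro s t hst ⟨C, hC⟩
    exact ⟨C, fun p hp => hC p (hst hp)⟩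
  · rintro s t ⟨C, hC⟩ ⟨D, hD⟩
    refine ⟨max C D, fun p hp hpM X hX => ?_⟩
    rcases hp with hp | hp
    · exact (hC p hp hpM X hX).trans (le_max_left _ _)
    · exact (hD p hp hpM X hX).trans (le_max_right _ _)
  · intro p₀ hp₀
    obtain ⟨C, V, hC, hV, htan, -, hlip⟩ := hM.exists_local_bounds hp₀
    refine ⟨interior V, mem_nhdsWithin_of_mem_nhds (interior_mem_nhds.2 hV), C,
      fun p hp hpM X hX => ?_⟩
    have hpV := interior_subset hp
    have hev : ∀ᶠ x in 𝓝[M] p,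
        ‖tangentProj M x X - tangentProj M p X‖ ≤ C * ‖X‖ * ‖x - p‖ := by
      filter_upwards [nhdsWithin_le_nhds (isOpen_interior.mem_nhds hp), self_mem_nhdsWithin]
        with x hx hxM
      rw [← sub_apply]
      refine ((tangentProj M x - tangentProj M p).le_opNorm X).trans ?_
      have := hlip p ⟨hpM, hpV⟩ x ⟨hxM, interior_subset hx⟩
      calc _ ≤ C * ‖x - p‖ * ‖X‖ := by gcongr
        _ = _ := by ring
    have h1 := norm_fderivWithin_apply_le_of_mem_tangentConeAt hev (by positivity)
      (htan p ⟨hpM, hpV⟩ X hX)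
    have h2 : ‖secondFundForm M p X X‖ ≤ C * ‖X‖ ^ 2 :=
      (norm_normalProj_apply_le M p _).trans (h1.trans_eq (by ring))
    exact div_le_of_le_mul₀ (by positivity) hC h2

/-- Compactness of `M ×ˢ M`: near the diagonal the local chord estimate applies, and away from it
the quotient is at most `‖p - q‖⁻¹`. -/
theorem chordSet_bddAbove {M : Set (Euc l)} (hM : IsC2Submanifold M) (hMc : IsCompact M) :
    BddAbove {r : ℝ | ∃ p ∈ M, ∃ q ∈ M, r = ‖normalProj M p (p - q)‖ / ‖p - q‖ ^ 2} := by
  suffices h : ∃ C : ℝ, ∀ z ∈ M ×ˢ M,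
      ‖normalProj M z.1 (z.1 - z.2)‖ / ‖z.1 - z.2‖ ^ 2 ≤ C by
    obtain ⟨C, hC⟩ := h
    refine ⟨C, ?_⟩
    rintro r ⟨p, hp, q, hq, rfl⟩
    exact hC (p, q) ⟨hp, hq⟩
  refine (hMc.prod hMc).induction_on (p := fun s => ∃ C : ℝ, ∀ z ∈ s, z ∈ M ×ˢ M →
      ‖normalProj M z.1 (z.1 - z.2)‖ / ‖z.1 - z.2‖ ^ 2 ≤ C) ⟨0, by simp⟩ ?_ ?_ ?_ |>.imp
      fun C hC p hp => hC p hp hp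
  · rintro s t hst ⟨C, hC⟩
    exact ⟨C, fun p hp => hC p (hst hp)⟩
  · rintro s t ⟨C, hC⟩ ⟨D, hD⟩
    refine ⟨max C D, fun p hp hpM => ?_⟩
    rcases hp with hp | hp
    · exact (hC p hp hpM).trans (le_max_left _ _)
    · exact (hD p hp hpM).trans (le_max_right _ _)
  · rintro ⟨p₀, q₀⟩ ⟨hp₀, hq₀⟩
    by_cases hpq : p₀ = q₀
    · subst hpq
      obtain ⟨C, V, hC, hV, -, hchord, -⟩ := hM.exists_local_bounds hp₀
      refine ⟨V ×ˢ V, mem_nhdsWithin_of_mem_nhds (prod_mem_nhds hV hV), C, ?_⟩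
      rintro ⟨p, q⟩ ⟨hp, hq⟩ ⟨hpM, hqM⟩
      exact div_le_of_le_mul₀ (by positivity) hC (hchord p ⟨hpM, hp⟩ q ⟨hqM, hq⟩)
    · set δ := ‖p₀ - q₀‖ / 2 with hδ
      have hδ0 : 0 < δ := half_pos (norm_pos_iff.2 (sub_ne_zero.2 hpq))
      have hcont : Continuous fun z : Euc l × Euc l => ‖z.1 - z.2‖ := by fun_prop
      have hev : ∀ᶠ z in 𝓝 (p₀, q₀), δ < ‖z.1 - z.2‖ :=
        hcont.continuousAt.eventually_const_lt (by
          show δ < ‖p₀ - q₀‖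
          linarith)
      refine ⟨{z | δ < ‖z.1 - z.2‖}, mem_nhdsWithin_of_mem_nhds hev, δ⁻¹, ?_⟩
      rintro ⟨p, q⟩ hz -
      have hz' : δ < ‖p - q‖ := hz
      refine div_le_of_le_mul₀ (by positivity) (by positivity) ?_
      refine (norm_normalProj_apply_le M p _).trans ?_
      rw [pow_two, ← mul_assoc, inv_mul_eq_div]
      exact le_mul_of_one_le_left (norm_nonneg _) ((one_le_div hδ0).2 hz'.le)

theorem curvBound_nonneg (M : Set (Euc l)) : 0 ≤ curvBound M :=
  Real.sSup_nonneg fun r hr => by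
    obtain ⟨p, -, X, -, rfl⟩ := hr
    positivity

theorem chordConst_nonneg (M : Set (Euc l)) : 0 ≤ chordConst M :=
  Real.sSup_nonneg fun r hr => by
    obtain ⟨p, -, q, -, rfl⟩ := hr
    positivity

theorem norm_secondFundForm_le {M : Set (Euc l)} (hM : IsC2Submanifold M) (hMc : IsCompact M)
    {p X : Euc l} (hp : p ∈ M) (hX : X ∈ tangentSpaceAt M p) :
    ‖secondFundForm M p X X‖ ≤ curvBound M * ‖X‖ ^ 2 := by
  rcases eq_or_ne X 0 with rfl | h
  · simp [secondFundForm]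
  · exact (div_le_iff₀ (by positivity)).1
      (le_csSup (curvSet_bddAbove hM hMc) ⟨p, hp, X, hX, rfl⟩)

theorem norm_normalProj_sub_le {M : Set (Euc l)} (hM : IsC2Submanifold M) (hMc : IsCompact M)
    {p q : Euc l} (hp : p ∈ M) (hq : q ∈ M) :
    ‖normalProj M p (p - q)‖ ≤ chordConst M * ‖p - q‖ ^ 2 := by
  rcases eq_or_ne p q with rfl | h
  · simp
  · have : 0 < ‖p - q‖ := norm_pos_iff.2 (sub_ne_zero.2 h)
    exact (div_le_iff₀ (by positivity)).1
      (le_csSup (chordSet_bddAbove hM hMc) ⟨p, hp, q, hq, rfl⟩)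

/-- Quantitative first and second order expansions of a geodesic. -/
theorem IsGeodesic.exists_velocity {M : Set (Euc l)} (hM : IsC2Submanifold M) (hMc : IsCompact M)
    {p V : Euc l} {γ : ℝ → Euc l} (hγ : IsGeodesic M p V γ) :
    ∃ γ' : ℝ → Euc l,
      (∀ s ∈ Ici (0 : ℝ), HasDerivWithinAt γ (γ' s) (Ici 0) s) ∧
      (∀ s ∈ Ici (0 : ℝ), ‖γ' s‖ = ‖V‖) ∧
      (∀ s ∈ Ici (0 : ℝ), ‖γ' s - V‖ ≤ curvBound M * ‖V‖ ^ 2 * s) ∧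
      (∀ s ∈ Ici (0 : ℝ), ‖γ s - p‖ ≤ ‖V‖ * s) ∧
      ∀ s ∈ Ici (0 : ℝ), ‖γ s - p - s • V‖ ≤ curvBound M * ‖V‖ ^ 2 * (s ^ 2 / 2) := by
  obtain ⟨h0, hmem, γ', hV, hd, hdd⟩ := hγ
  have hone : ∀ s ∈ Ici (0 : ℝ), (1 : ℝ) ∈ tangentConeAt ℝ (Ici (0 : ℝ)) s := fun s hs => by
    have : segment ℝ s (s + 1) ⊆ Ici (0 : ℝ) := by
      rw [segment_eq_Icc (by linarith)]
      exact fun x hx => le_trans (mem_Ici.1 hs) hx.1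
    simpa using mem_tangentConeAt_of_segment_subset this
  have htan : ∀ s ∈ Ici (0 : ℝ), γ' s ∈ tangentSpaceAt M (γ s) := fun s hs => by
    have h1 := (hd s hs).hasFDerivWithinAt.mapsTo_tangent_cone (hone s hs)
    have h2 := tangentConeAt_mono (𝕜 := ℝ) (x := γ s)
      (image_subset_iff.2 hmem : γ '' Ici 0 ⊆ M) h1
    exact Submodule.subset_span (by simpa using h2)
  -- The acceleration is normal and the velocity tangent, so the squared speed has zero derivative.
  have hspeed : ∀ s ∈ Ici (0 : ℝ), ‖γ' s‖ = ‖V‖ := fun s hs => by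
    have hsq : ∀ x ∈ Ici (0 : ℝ), HasDerivWithinAt (fun x => ‖γ' x‖ ^ 2) 0 (Ici 0) x :=
      fun x hx => by
        have := (hdd x hx).norm_sq
        rwa [secondFundForm_mem_normal M _ (htan x hx), mul_zero] at this
    have h1 := (convex_Ici (0 : ℝ)).norm_image_sub_le_of_norm_hasDerivWithin_le (C := 0) hsq
      (fun x _ => by simp) (mem_Ici.2 le_rfl) hs
    rw [zero_mul, hV] at h1
    have h2 := sub_eq_zero.1 (norm_le_zero_iff.1 h1)
    exact (pow_left_inj₀ (norm_nonneg _) (norm_nonneg _) two_ne_zero).1 h2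
  have hvel : ∀ s ∈ Ici (0 : ℝ), ‖γ' s - V‖ ≤ curvBound M * ‖V‖ ^ 2 * s := fun s hs => by
    have h1 := (convex_Ici (0 : ℝ)).norm_image_sub_le_of_norm_hasDerivWithin_le
      (C := curvBound M * ‖V‖ ^ 2) hdd
      (fun x hx => (norm_secondFundForm_le hM hMc (hmem x hx) (htan x hx)).trans
        (by rw [hspeed x hx])) (mem_Ici.2 le_rfl) hs
    rwa [hV, sub_zero, Real.norm_of_nonneg hs] at h1
  refine ⟨γ', hd, hspeed, hvel, fun s hs => ?_, fun s hs => ?_⟩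
  · have h1 := (convex_Ici (0 : ℝ)).norm_image_sub_le_of_norm_hasDerivWithin_le (C := ‖V‖) hd
      (fun x hx => (hspeed x hx).le) (mem_Ici.2 le_rfl) hs
    rwa [h0, sub_zero, Real.norm_of_nonneg hs] at h1
  · have hder : ∀ x ∈ Ici (0 : ℝ),
        HasDerivWithinAt (fun x => γ x - p - x • V) (γ' x - V) (Ici 0) x := fun x hx => by
      have h2 := ((hasDerivWithinAt_id x (Ici (0 : ℝ))).smul_const V)
      rw [one_smul] at h2
      exact ((hd x hx).sub_const p).sub h2
    refine image_norm_le_of_norm_deriv_right_le_deriv_boundary (a := 0) (b := s)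
      (f := fun x => γ x - p - x • V) (f' := fun x => γ' x - V)
      (B := fun x => curvBound M * ‖V‖ ^ 2 * (x ^ 2 / 2))
      (B' := fun x => curvBound M * ‖V‖ ^ 2 * x)
      (fun x hx => (hder x hx.1).continuousWithinAt.mono Icc_subset_Ici_self)
      (fun x hx => (hder x hx.1).mono (Ici_subset_Ici.2 hx.1)) (by simp [h0]) (fun x => ?_)
      (fun x hx => hvel x hx.1) (right_mem_Icc.2 hs)
    have := ((hasDerivAt_pow 2 x).div_const 2).const_mul (curvBound M * ‖V‖ ^ 2)
    simpa using this

end Submanifold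

/-! ### The Hilbert space of piecewise constant maps -/

section Partition

variable {k l : ℕ} {Δ : Type*}

def cellVol (cell : Δ → Set (Euc k)) (α : Δ) : ℝ := (volume (cell α)).toReal

theorem cellVol_nonneg (cell : Δ → Set (Euc k)) (α : Δ) : 0 ≤ cellVol cell α :=
  ENNReal.toReal_nonneg

theorem IsRectPartition.subset {Ω : Set (Euc k)} {cell : Δ → Set (Euc k)}
    (h : IsRectPartition Ω cell) (α : Δ) : cell α ⊆ Ω := by
  obtain ⟨a, b, -, hab⟩ := h.box α
  rw [hab]
  exact inter_subset_right

theorem IsRectPartition.isOpen {Ω : Set (Euc k)} {cell : Δ → Set (Euc k)}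
    (h : IsRectPartition Ω cell) (hΩ : IsOpen Ω) (α : Δ) : IsOpen (cell α) := by
  obtain ⟨a, b, -, hab⟩ := h.box α
  rw [hab]
  refine IsOpen.inter ?_ hΩ
  have : {x : Euc k | ∀ j, a j < x j ∧ x j < b j} = ⋂ j, {x : Euc k | a j < x j ∧ x j < b j} := by
    ext
    simp
  rw [this]
  refine isOpen_iInter_of_finite fun j => ?_
  exact (isOpen_lt continuous_const (EuclideanSpace.proj j).continuous).inter
    (isOpen_lt (EuclideanSpace.proj j).continuous continuous_const)

theorem IsRectPartition.volume_ne_top {Ω : Set (Euc k)} {cell : Δ → Set (Euc k)}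
    (h : IsRectPartition Ω cell) (hb : Bornology.IsBounded Ω) (α : Δ) : volume (cell α) ≠ ⊤ :=
  ((measure_mono (h.subset α)).trans_lt hb.measure_lt_top).ne

theorem IsRectPartition.cellVol_pos {Ω : Set (Euc k)} {cell : Δ → Set (Euc k)}
    (h : IsRectPartition Ω cell) (hΩ : IsOpen Ω) (hb : Bornology.IsBounded Ω) (α : Δ) :
    0 < cellVol cell α :=
  ENNReal.toReal_pos ((h.isOpen hΩ α).measure_pos volume (h.nonempty α)).ne' (h.volume_ne_top hb α)

variable [Fintype Δ]

theorem minVol_le (cell : Δ → Set (Euc k)) (α : Δ) : minVol cell ≤ cellVol cell α :=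
  ciInf_le (finite_range _).bddBelow α

theorem IsRectPartition.minVol_pos [Nonempty Δ] {Ω : Set (Euc k)} {cell : Δ → Set (Euc k)}
    (h : IsRectPartition Ω cell) (hΩ : IsOpen Ω) (hb : Bornology.IsBounded Ω) :
    0 < minVol cell := by
  obtain ⟨α, hα⟩ := exists_eq_ciInf_of_finite (f := fun α => (volume (cell α)).toReal)
  rw [minVol, ← hα]
  exact h.cellVol_pos hΩ hb α

theorem IsRectPartition.sum_cellVol_le {Ω : Set (Euc k)} {cell : Δ → Set (Euc k)}
    (h : IsRectPartition Ω cell) (hΩ : IsOpen Ω) (hb : Bornology.IsBounded Ω) :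
    ∑ α, cellVol cell α ≤ (volume Ω).toReal := by
  have h1 : volume (⋃ α, cell α) = ∑ α, volume (cell α) := by
    rw [measure_iUnion₀ (fun α β hαβ => h.disj α β hαβ)
      (fun α => (h.isOpen hΩ α).measurableSet.nullMeasurableSet), tsum_fintype]
  have h2 : volume (⋃ α, cell α) ≤ volume Ω := measure_mono (iUnion_subset h.subset)
  calc ∑ α, cellVol cell α = (∑ α, volume (cell α)).toReal :=
        (ENNReal.toReal_sum fun α _ => h.volume_ne_top hb α).symm
    _ ≤ (volume Ω).toReal := by
        rw [← h1]
        exact ENNReal.toReal_mono hb.measure_lt_top.ne h2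

/-- The isometric embedding of `H_Δ` into a Euclidean product, obtained by scaling the value on
each cell by the square root of the volume of the cell. -/
def hEmb (cell : Δ → Set (Euc k)) : (Δ → Euc l) →ₗ[ℝ] PiLp 2 (fun _ : Δ => Euc l) where
  toFun U := WithLp.toLp 2 fun α => √(cellVol cell α) • U α
  map_add' U V := by
    ext1 α
    simp
  map_smul' c U := by
    ext1 α
    simp [smul_comm c]

theorem inner_hEmb (cell : Δ → Set (Euc k)) (U V : Δ → Euc l) :
    inner ℝ (hEmb cell U) (hEmb cell V) = ∑ α, cellVol cell α * inner ℝ (U α) (V α) := by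
  rw [PiLp.inner_apply]
  refine Finset.sum_congr rfl fun α _ => ?_
  simp only [hEmb, LinearMap.coe_mk, AddHom.coe_mk]
  rw [real_inner_smul_left, real_inner_smul_right, ← mul_assoc,
    Real.mul_self_sqrt (cellVol_nonneg cell α)]

theorem norm_hEmb_sq (cell : Δ → Set (Euc k)) (U : Δ → Euc l) :
    ‖hEmb cell U‖ ^ 2 = ∑ α, cellVol cell α * ‖U α‖ ^ 2 := by
  rw [← real_inner_self_eq_norm_sq, inner_hEmb]
  simp only [real_inner_self_eq_norm_sq]

/-- The product of two step functions expands into indicators of pairwise intersections of cells;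
off the diagonal these are null sets. -/
theorem hInner_eq_inner {Ω : Set (Euc k)} {cell : Δ → Set (Euc k)} (h : IsRectPartition Ω cell)
    (hΩ : IsOpen Ω) (hb : Bornology.IsBounded Ω) (U V : Δ → Euc l) :
    hInner Ω cell U V = inner ℝ (hEmb cell U) (hEmb cell V) := by
  have hmeas : ∀ α, MeasurableSet (cell α) := fun α => (h.isOpen hΩ α).measurableSet
  have hpt : ∀ x, inner ℝ (stepFun cell U x) (stepFun cell V x)
      = ∑ α, ∑ β, (cell α ∩ cell β).indicator (fun _ => (inner ℝ (U α) (V β) : ℝ)) x := fun x => by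
    simp only [stepFun, sum_inner, inner_sum]
    refine (Finset.sum_comm).trans (Finset.sum_congr rfl fun α _ => Finset.sum_congr rfl fun β _ => ?_)
    by_cases hα : x ∈ cell α <;> by_cases hβ : x ∈ cell β <;> simp [hα, hβ]
  have hsub : ∀ α β, cell α ∩ cell β ⊆ Ω := fun α β => inter_subset_left.trans (h.subset α)
  have hint : ∀ α β, IntegrableOn
      ((cell α ∩ cell β).indicator (fun _ => (inner ℝ (U α) (V β) : ℝ))) Ω := fun α β => by
    refine IntegrableOn.indicator ?_ ((hmeas α).inter (hmeas β))
    exact integrableOn_const hb.measure_lt_top.ne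
  rw [hInner, inner_hEmb]
  simp only [hpt]
  rw [integral_finsetSum _ fun α _ => integrable_finsetSum _ fun β _ => hint α β]
  refine Finset.sum_congr rfl fun α _ => ?_
  rw [integral_finsetSum _ fun β _ => hint α β]
  have hval : ∀ β, ∫ x in Ω, (cell α ∩ cell β).indicator (fun _ => (inner ℝ (U α) (V β) : ℝ)) x
      = (volume (cell α ∩ cell β)).toReal * inner ℝ (U α) (V β) := fun β => by
    rw [setIntegral_indicator ((hmeas α).inter (hmeas β)), inter_eq_self_of_subset_right (hsub α β),
      setIntegral_const, smul_eq_mul, Measure.real]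
  simp only [hval]
  rw [Finset.sum_eq_single α]
  · rw [inter_self, cellVol]
  · intro β _ hβ
    rw [h.disj α β hβ.symm]
    simp
  · simp

theorem hNorm_eq_norm {Ω : Set (Euc k)} {cell : Δ → Set (Euc k)} (h : IsRectPartition Ω cell)
    (hΩ : IsOpen Ω) (hb : Bornology.IsBounded Ω) (U : Δ → Euc l) :
    hNorm Ω cell U = ‖hEmb cell U‖ := by
  have := hInner_eq_inner h hΩ hb U U
  rw [real_inner_self_eq_norm_sq, hInner] at this
  simp only [real_inner_self_eq_norm_sq] at this
  rw [hNorm, this, Real.sqrt_sq (norm_nonneg _)]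

theorem hEmb_injective {cell : Δ → Set (Euc k)} (hpos : ∀ α, 0 < cellVol cell α) :
    Function.Injective (hEmb (l := l) cell) := by
  rw [injective_iff_map_eq_zero]
  intro U hU
  have h1 := norm_hEmb_sq cell U
  rw [hU, norm_zero, zero_pow two_ne_zero, eq_comm, Finset.sum_eq_zero_iff_of_nonneg
    fun α _ => mul_nonneg (hpos α).le (sq_nonneg _)] at h1
  funext α
  have := h1 α (Finset.mem_univ α)
  simpa [(hpos α).ne'] using this

/-- An inverse estimate: one factor `‖X α‖ ^ 2` is bounded by `v⁻¹ * ‖hEmb cell X‖ ^ 2`, the other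
is summed. -/
theorem norm_hEmb_le_of_sq [Nonempty Δ] {cell : Δ → Set (Euc k)} (hv : 0 < minVol cell)
    {X Y : Δ → Euc l} {c : ℝ} (hc : 0 ≤ c) (hXY : ∀ α, ‖Y α‖ ≤ c * ‖X α‖ ^ 2) :
    ‖hEmb cell Y‖ ≤ c * minVol cell ^ (-(1 / 2) : ℝ) * ‖hEmb cell X‖ ^ 2 := by
  set v := minVol cell with hvdef
  set S := ‖hEmb cell X‖ ^ 2 with hS
  have hκ : (v ^ (-(1 / 2) : ℝ)) ^ 2 = v⁻¹ := by
    rw [← Real.rpow_natCast, ← Real.rpow_mul hv.le, ← Real.rpow_neg_one]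
    norm_num
  have hterm : ∀ α, ‖X α‖ ^ 2 ≤ v⁻¹ * S := fun α => by
    have h1 : cellVol cell α * ‖X α‖ ^ 2 ≤ S := by
      rw [hS, norm_hEmb_sq]
      exact Finset.single_le_sum (f := fun α => cellVol cell α * ‖X α‖ ^ 2)
        (fun β _ => mul_nonneg (cellVol_nonneg cell β) (sq_nonneg _)) (Finset.mem_univ α)
    have h2 : v * ‖X α‖ ^ 2 ≤ S :=
      (mul_le_mul_of_nonneg_right (minVol_le cell α) (sq_nonneg _)).trans h1
    rw [inv_mul_eq_div, le_div_iff₀ hv]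
    linarith
  have hκ0 : 0 ≤ v ^ (-(1 / 2) : ℝ) := Real.rpow_nonneg hv.le _
  refine (abs_le_of_sq_le_sq' ?_ (by positivity)).2
  rw [mul_pow, mul_pow, hκ, norm_hEmb_sq]
  calc ∑ α, cellVol cell α * ‖Y α‖ ^ 2
      ≤ ∑ α, (c ^ 2 * (v⁻¹ * S)) * (cellVol cell α * ‖X α‖ ^ 2) := by
        refine Finset.sum_le_sum fun α _ => ?_
        have h1 : ‖Y α‖ ^ 2 ≤ (c * ‖X α‖ ^ 2) ^ 2 := by
          gcongr
          exact hXY α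
        have h2 : ‖Y α‖ ^ 2 ≤ c ^ 2 * (v⁻¹ * S) * ‖X α‖ ^ 2 := by
          refine h1.trans ?_
          rw [mul_pow, mul_assoc, pow_two (‖X α‖ ^ 2)]
          gcongr
          exact hterm α
        calc _ ≤ cellVol cell α * (c ^ 2 * (v⁻¹ * S) * ‖X α‖ ^ 2) :=
              mul_le_mul_of_nonneg_left h2 (cellVol_nonneg cell α)
          _ = _ := by ring
    _ = c ^ 2 * v⁻¹ * S ^ 2 := by
        rw [← Finset.mul_sum, ← norm_hEmb_sq, ← hS]
        ring

theorem norm_hEmb_le_of_bound {Ω : Set (Euc k)} {cell : Δ → Set (Euc k)}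
    (h : IsRectPartition Ω cell) (hΩ : IsOpen Ω) (hb : Bornology.IsBounded Ω)
    {Y : Δ → Euc l} {d : ℝ} (hd : 0 ≤ d) (hY : ∀ α, ‖Y α‖ ≤ d) :
    ‖hEmb cell Y‖ ≤ d * (volume Ω).toReal ^ (1 / 2 : ℝ) := by
  rw [← Real.sqrt_eq_rpow]
  refine (abs_le_of_sq_le_sq' ?_ (by positivity)).2
  rw [mul_pow, Real.sq_sqrt ENNReal.toReal_nonneg, norm_hEmb_sq]
  calc ∑ α, cellVol cell α * ‖Y α‖ ^ 2 ≤ ∑ α, d ^ 2 * cellVol cell α := by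
        refine Finset.sum_le_sum fun α _ => ?_
        rw [mul_comm]
        have := cellVol_nonneg cell α
        gcongr
        exact hY α
    _ ≤ d ^ 2 * (volume Ω).toReal := by
        rw [← Finset.mul_sum]
        gcongr
        exact h.sum_cellVol_le hΩ hb

theorem norm_hEmb_le_of_le (cell : Δ → Set (Euc k)) {X Y : Δ → Euc l} {c : ℝ} (hc : 0 ≤ c)
    (hXY : ∀ α, ‖Y α‖ ≤ c * ‖X α‖) : ‖hEmb cell Y‖ ≤ c * ‖hEmb cell X‖ := by
  refine (abs_le_of_sq_le_sq' ?_ (by positivity)).2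
  rw [mul_pow, norm_hEmb_sq, norm_hEmb_sq, Finset.mul_sum]
  refine Finset.sum_le_sum fun α _ => ?_
  calc cellVol cell α * ‖Y α‖ ^ 2 ≤ cellVol cell α * (c * ‖X α‖) ^ 2 := by
        have := cellVol_nonneg cell α
        gcongr
        exact hXY α
    _ = _ := by ring

end Partition

/-! ### Cellwise tangent vectors and projections -/

section TangentMaps

variable {l : ℕ} {Δ : Type*}

theorem tangentMaps_add {M : Set (Euc l)} {u X Y : Δ → Euc l} (hX : X ∈ tangentMaps M u)
    (hY : Y ∈ tangentMaps M u) : X + Y ∈ tangentMaps M u :=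
  fun α => Submodule.add_mem _ (hX α) (hY α)

theorem tangentMaps_smul {M : Set (Euc l)} {u X : Δ → Euc l} (c : ℝ) (hX : X ∈ tangentMaps M u) :
    c • X ∈ tangentMaps M u :=
  fun α => Submodule.smul_mem _ c (hX α)

theorem projMaps_mem (M : Set (Euc l)) (u X : Δ → Euc l) : projMaps M u X ∈ tangentMaps M u :=
  fun α => tangentProj_mem M (u α) (X α)

theorem projMaps_eq_self {M : Set (Euc l)} {u X : Δ → Euc l} (hX : X ∈ tangentMaps M u) :
    projMaps M u X = X :=
  funext fun α => Submodule.starProjection_eq_self_iff.2 (hX α)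

end TangentMaps

/-! ### The discrete total variation -/

section TotalVariation

variable {k l : ℕ} {Δ : Type*} [Fintype Δ]

theorem discreteTV_add_le (cell : Δ → Set (Euc k)) (U V : Δ → Euc l) :
    discreteTV cell (U + V) ≤ discreteTV cell U + discreteTV cell V := by
  classical
  rw [discreteTV, discreteTV, discreteTV, ← Finset.sum_add_distrib]
  refine Finset.sum_le_sum fun γ _ => ?_
  split_ifs
  · rw [← add_mul]
    refine mul_le_mul_of_nonneg_right ?_ ENNReal.toReal_nonneg
    induction γ with
    | h α β =>
      simp only [Sym2.lift_mk, Pi.add_apply]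
      rw [add_sub_add_comm]
      exact norm_add_le _ _
  · simp

theorem discreteTV_smul (cell : Δ → Set (Euc k)) (c : ℝ) (U : Δ → Euc l) :
    discreteTV cell (c • U) = |c| * discreteTV cell U := by
  classical
  rw [discreteTV, discreteTV, Finset.mul_sum]
  refine Finset.sum_congr rfl fun γ _ => ?_
  split_ifs
  · rw [← mul_assoc]
    congr 1
    induction γ with
    | h α β =>
      simp only [Sym2.lift_mk, Pi.smul_apply]
      rw [← smul_sub, norm_smul, Real.norm_eq_abs]
  · simp

theorem exists_discreteTV_le_mul_norm (cell : Δ → Set (Euc k)) :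
    ∃ C : ℝ, 0 ≤ C ∧ ∀ U : Δ → Euc l, discreteTV cell U ≤ C * ‖U‖ := by
  classical
  refine ⟨∑ γ : Sym2 Δ, 2 * (edgeMeasure cell γ).toReal, by positivity, fun U => ?_⟩
  rw [discreteTV, Finset.sum_mul]
  refine Finset.sum_le_sum fun γ _ => ?_
  split_ifs
  · have : Sym2.lift ⟨fun α β => ‖U α - U β‖, fun α β => norm_sub_rev (U α) (U β)⟩ γ
        ≤ 2 * ‖U‖ := by
      induction γ with
      | h α β =>
        simp only [Sym2.lift_mk]
        have := norm_sub_le (U α) (U β)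
        have := norm_le_pi_norm U α
        have := norm_le_pi_norm U β
        linarith
    calc _ ≤ 2 * ‖U‖ * (edgeMeasure cell γ).toReal :=
          mul_le_mul_of_nonneg_right this ENNReal.toReal_nonneg
      _ = _ := by ring
  · positivity

theorem abs_discreteTV_sub_le (cell : Δ → Set (Euc k)) (U V : Δ → Euc l) :
    |discreteTV cell U - discreteTV cell V| ≤ discreteTV cell (U - V) := by
  have h1 := discreteTV_add_le cell (U - V) V
  have h2 := discreteTV_add_le cell (V - U) U
  have h3 : discreteTV cell (V - U) = discreteTV cell (U - V) := by
    have := discreteTV_smul cell (-1) (U - V)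
    simpa using this
  rw [sub_add_cancel] at h1 h2
  rw [abs_le]
  constructor <;> linarith

variable {Ω : Set (Euc k)} {cell : Δ → Set (Euc k)}

theorem lipTV_nonneg (l : ℕ) (Ω : Set (Euc k)) (cell : Δ → Set (Euc k)) : 0 ≤ lipTV l Ω cell :=
  Real.sSup_nonneg fun r hr => by
    obtain ⟨U, V, rfl⟩ := hr
    exact div_nonneg (abs_nonneg _) (Real.sqrt_nonneg _)

/-- The total variation is a seminorm dominated by the sup norm, which on this finite-dimensional
space is dominated by the $L^2$ norm. Hence the set of quotients is bounded above and its supremum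
is a Lipschitz constant. -/
theorem abs_discreteTV_sub_le_lipTV (h : IsRectPartition Ω cell) (hΩ : IsOpen Ω)
    (hb : Bornology.IsBounded Ω) (U V : Δ → Euc l) :
    |discreteTV cell U - discreteTV cell V| ≤ lipTV l Ω cell * ‖hEmb cell (U - V)‖ := by
  have hinj := hEmb_injective (l := l) (h.cellVol_pos hΩ hb)
  obtain ⟨C, hC0, hC⟩ := exists_discreteTV_le_mul_norm (l := l) cell
  obtain ⟨K, -, hK⟩ := LinearMap.exists_antilipschitzWith (hEmb (l := l) cell)
    (LinearMap.ker_eq_bot.2 hinj)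
  have hK' : ∀ W : Δ → Euc l, ‖W‖ ≤ K * ‖hEmb cell W‖ := fun W => by
    simpa using hK.le_mul_dist W 0
  have hbound : ∀ U V : Δ → Euc l,
      |discreteTV cell U - discreteTV cell V| ≤ C * K * ‖hEmb cell (U - V)‖ := fun U V =>
    calc _ ≤ C * ‖U - V‖ := (abs_discreteTV_sub_le cell U V).trans (hC _)
      _ ≤ C * (K * ‖hEmb cell (U - V)‖) := by gcongr; exact hK' _
      _ = _ := by ring
  have hbdd : BddAbove {r : ℝ | ∃ U V : Δ → Euc l,
      r = |discreteTV cell U - discreteTV cell V| / hNorm Ω cell (U - V)} := by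
    refine ⟨C * K, ?_⟩
    rintro r ⟨U, V, rfl⟩
    rw [hNorm_eq_norm h hΩ hb]
    exact div_le_of_le_mul₀ (norm_nonneg _) (by positivity) (hbound U V)
  rcases eq_or_ne (hEmb cell (U - V)) 0 with h0 | h0
  · have := hbound U V
    rw [h0, norm_zero, mul_zero] at this ⊢
    exact this
  · have := le_csSup hbdd ⟨U, V, rfl⟩
    rw [hNorm_eq_norm h hΩ hb] at this
    exact (div_le_iff₀ (norm_pos_iff.2 h0)).1 this

theorem discreteTV_sub_le_lipTV (h : IsRectPartition Ω cell) (hΩ : IsOpen Ω)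
    (hb : Bornology.IsBounded Ω) (U V : Δ → Euc l) :
    discreteTV cell U - discreteTV cell V ≤ lipTV l Ω cell * ‖hEmb cell (U - V)‖ :=
  (le_abs_self _).trans (abs_discreteTV_sub_le_lipTV h hΩ hb U V)

theorem inner_le_of_mem_subdiffTV (h : IsRectPartition Ω cell) (hΩ : IsOpen Ω)
    (hb : Bornology.IsBounded Ω) {U ζ : Δ → Euc l} (hζ : ζ ∈ subdiffTV Ω cell U)
    (V : Δ → Euc l) :
    inner ℝ (hEmb cell ζ) (hEmb cell (V - U)) ≤ discreteTV cell V - discreteTV cell U := by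
  have := hζ V
  rw [hInner_eq_inner h hΩ hb] at this
  linarith

theorem norm_le_lipTV_of_mem_subdiffTV (h : IsRectPartition Ω cell) (hΩ : IsOpen Ω)
    (hb : Bornology.IsBounded Ω) {U ζ : Δ → Euc l} (hζ : ζ ∈ subdiffTV Ω cell U) :
    ‖hEmb cell ζ‖ ≤ lipTV l Ω cell := by
  have h1 := inner_le_of_mem_subdiffTV h hΩ hb hζ (U + ζ)
  have h2 := discreteTV_sub_le_lipTV h hΩ hb (U + ζ) U
  rw [add_sub_cancel_left] at h1 h2
  rw [real_inner_self_eq_norm_sq] at h1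
  rcases (norm_nonneg (hEmb cell ζ)).eq_or_lt with h0 | h0
  · rw [← h0]
    exact lipTV_nonneg _ _ _
  · nlinarith

/-- The variational inequality satisfied by a minimizer of the localized energy. -/
theorem inner_le_of_isMinOn_localEnergy (h : IsRectPartition Ω cell) (hΩ : IsOpen Ω)
    (hb : Bornology.IsBounded Ω) {M : Set (Euc l)} {τ : ℝ} (hτ : 0 < τ) {p X : Δ → Euc l}
    (hX : X ∈ tangentMaps M p)
    (hmin : IsMinOn (localEnergy Ω cell τ p) (tangentMaps M p) X) {Y : Δ → Euc l}
    (hY : Y ∈ tangentMaps M p) :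
    inner ℝ (hEmb cell X) (hEmb cell (X - Y))
      ≤ τ * (discreteTV cell (p + Y) - discreteTV cell (p + X)) := by
  set a := τ * (discreteTV cell (p + Y) - discreteTV cell (p + X))
    - inner ℝ (hEmb cell X) (hEmb cell (X - Y)) with ha
  set b := ‖hEmb cell (X - Y)‖ ^ 2 with hbdef
  -- Compare `X` with `X - t • (X - Y)`: by convexity the gain in energy is at least zero and at
  -- most `t * (a + t * (b / 2))`. Divide by `t`; below, `t` tends to zero.
  have key : ∀ t ∈ Ioc (0 : ℝ) 1, 0 ≤ a + t * (b / 2) := fun t ht => by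
    have hZ : X + t • (Y + (-1 : ℝ) • X) ∈ tangentMaps M p :=
      tangentMaps_add hX (tangentMaps_smul t (tangentMaps_add hY (tangentMaps_smul _ hX)))
    have h1 := isMinOn_iff.1 hmin _ hZ
    have e1 : X + t • (Y + (-1 : ℝ) • X) = X - t • (X - Y) := by
      module
    have e2 : p + (X - t • (X - Y)) = (1 - t) • (p + X) + t • (p + Y) := by
      module
    have h2 : discreteTV cell (p + (X - t • (X - Y)))
        ≤ (1 - t) * discreteTV cell (p + X) + t * discreteTV cell (p + Y) := by
      rw [e2]
      refine (discreteTV_add_le cell _ _).trans ?_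
      rw [discreteTV_smul, discreteTV_smul, abs_of_nonneg ht.1.le,
        abs_of_nonneg (sub_nonneg.2 ht.2)]
    have h3 : ‖hEmb cell (X - t • (X - Y))‖ ^ 2 = ‖hEmb cell X‖ ^ 2
        - 2 * (t * inner ℝ (hEmb cell X) (hEmb cell (X - Y))) + t ^ 2 * b := by
      rw [map_sub, map_smul, norm_sub_sq_real, real_inner_smul_right, norm_smul, mul_pow,
        Real.norm_eq_abs, sq_abs]
    rw [e1, localEnergy, localEnergy, hNorm_eq_norm h hΩ hb, hNorm_eq_norm h hΩ hb, h3] at h1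
    have h4 := mul_le_mul_of_nonneg_left h2 hτ.le
    have h5 : 0 ≤ t * (a + t * (b / 2)) := by
      rw [ha]
      nlinarith
    exact nonneg_of_mul_nonneg_right h5 ht.1
  suffices 0 ≤ a by linarith
  refine ge_of_tendsto' (x := atTop) (f := fun n : ℕ => a + (1 / ((n : ℝ) + 1)) * (b / 2)) ?_
    fun n => key _ ⟨by positivity, ?_⟩
  · have := (tendsto_one_div_add_atTop_nhds_zero_nat (𝕜 := ℝ)).mul_const (b / 2)
    simpa using this.const_add a
  · rw [div_le_one (by positivity)]
    have : (0 : ℝ) ≤ n := n.cast_nonneg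
    linarith

/-- Testing with `Y = 0` gives
$\|X\|^2\le\tau(TV_\Delta(p)-TV_\Delta(p+X))\le\tau\,\mathrm{Lip}(TV_\Delta)\|X\|$. -/
theorem norm_le_of_isMinOn_localEnergy (h : IsRectPartition Ω cell) (hΩ : IsOpen Ω)
    (hb : Bornology.IsBounded Ω) {M : Set (Euc l)} {τ : ℝ} (hτ : 0 < τ) {p X : Δ → Euc l}
    (hX : X ∈ tangentMaps M p)
    (hmin : IsMinOn (localEnergy Ω cell τ p) (tangentMaps M p) X) :
    ‖hEmb cell X‖ ≤ τ * lipTV l Ω cell := by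
  have h1 := inner_le_of_isMinOn_localEnergy h hΩ hb hτ hX hmin
    (Y := 0) (fun α => Submodule.zero_mem _)
  have h2 := discreteTV_sub_le_lipTV h hΩ hb (p + 0) (p + X)
  rw [add_zero, sub_add_cancel_left, map_neg, norm_neg] at h2
  rw [sub_zero, add_zero, real_inner_self_eq_norm_sq] at h1
  have h3 := mul_le_mul_of_nonneg_left h2 hτ.le
  rcases (norm_nonneg (hEmb cell X)).eq_or_lt with h0 | h0
  · rw [← h0]
    exact mul_nonneg hτ.le (lipTV_nonneg _ _ _)
  · nlinarith

theorem inner_projMaps_left (cell : Δ → Set (Euc k)) (M : Set (Euc l)) (u X Y : Δ → Euc l) :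
    inner ℝ (hEmb cell (projMaps M u X)) (hEmb cell Y)
      = inner ℝ (hEmb cell X) (hEmb cell (projMaps M u Y)) := by
  simp only [inner_hEmb, projMaps, inner_tangentProj_left]

theorem norm_hEmb_projMaps_le (cell : Δ → Set (Euc k)) (M : Set (Euc l)) (u X : Δ → Euc l) :
    ‖hEmb cell (projMaps M u X)‖ ≤ ‖hEmb cell X‖ := by
  have := norm_hEmb_le_of_le cell (X := X) (Y := projMaps M u X) (c := 1) zero_le_one fun α => by
    rw [one_mul]
    exact Submodule.norm_starProjection_apply_le _ _
  simpa using this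

/-- The difference of two maps into `M` is tangential up to a quadratic error. -/
theorem norm_sub_projMaps_le [Nonempty Δ] (hv : 0 < minVol cell) {M : Set (Euc l)}
    (hM : IsC2Submanifold M) (hMc : IsCompact M) {u w : Δ → Euc l} (hu : u ∈ mapsInto M)
    (hw : w ∈ mapsInto M) :
    ‖hEmb cell (w - u - projMaps M u (w - u))‖
      ≤ chordConst M * minVol cell ^ (-(1 / 2) : ℝ) * ‖hEmb cell (w - u)‖ ^ 2 := by
  refine norm_hEmb_le_of_sq hv (chordConst_nonneg M) fun α => ?_
  have h1 : (w - u - projMaps M u (w - u)) α = normalProj M (u α) (w α - u α) := by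
    have := tangentProj_add_normalProj M (u α) (w α - u α)
    simp only [Pi.sub_apply, projMaps]
    rw [sub_eq_iff_eq_add', this]
  rw [h1, ← neg_sub, map_neg, norm_neg, Pi.sub_apply, norm_sub_rev (w α)]
  exact norm_normalProj_sub_le hM hMc (hu α) (hw α)

end TotalVariation

/-! ### A Gronwall inequality for Lipschitz curves -/

section Gronwall

theorem AbsolutelyContinuousOnInterval.le_of_ae_deriv_nonpos {F : ℝ → ℝ} {a b : ℝ} (hab : a ≤ b)
    (hF : AbsolutelyContinuousOnInterval F a b)
    (hd : ∀ᵐ t, t ∈ Ioo a b → ∃ F', HasDerivAt F F' t ∧ F' ≤ 0) : F b ≤ F a := by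
  have h1 := hF.integral_deriv_eq_sub
  have h2 : ∫ x in a..b, deriv F x ≤ 0 := by
    rw [intervalIntegral.integral_of_le hab, integral_Ioc_eq_integral_Ioo]
    refine integral_nonpos_of_ae ?_
    refine (ae_restrict_iff' measurableSet_Ioo).2 ?_
    filter_upwards [hd] with t ht hmem
    obtain ⟨F', hF', hle⟩ := ht hmem
    rw [hF'.deriv]
    exact hle
  linarith

/-- The conclusion compares one function of time at `b` and at `a`, so that consecutive intervals
can be chained. The Lipschitz bound serves only to make `‖z t‖ ^ 2` absolutely continuous. -/
theorem exp_mul_norm_sq_sub_le {H : Type*} [NormedAddCommGroup H] [InnerProductSpace ℝ H]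
    {z : ℝ → H} {a b C c L : ℝ} (ha : 0 ≤ a) (hab : a ≤ b) (hC : 0 ≤ C) (hc : 0 ≤ c)
    (hL : ∀ s ∈ Icc a b, ∀ t ∈ Icc a b, ‖z s - z t‖ ≤ L * |s - t|)
    (hd : ∀ᵐ t, t ∈ Ioo a b → ∃ z', HasDerivAt z z' t ∧
      2 * inner ℝ (z t) z' ≤ C * ‖z t‖ ^ 2 + c) :
    Real.exp (-(C * b)) * ‖z b‖ ^ 2 - c * b ≤ Real.exp (-(C * a)) * ‖z a‖ ^ 2 - c * a := by
  have hB : ∀ t ∈ Icc a b, ‖z t‖ ≤ ‖z a‖ + |L| * (b - a) := fun t ht => by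
    have h1 := hL t ht a (left_mem_Icc.2 hab)
    have h2 : ‖z t‖ ≤ ‖z a‖ + ‖z t - z a‖ := by
      have := norm_add_le (z a) (z t - z a)
      rwa [add_sub_cancel] at this
    have h3 : L * |t - a| ≤ |L| * (b - a) := by
      rw [abs_of_nonneg (sub_nonneg.2 ht.1)]
      exact mul_le_mul (le_abs_self L) (by linarith [ht.2]) (sub_nonneg.2 ht.1) (abs_nonneg L)
    linarith
  set B := ‖z a‖ + |L| * (b - a) with hBdef
  have hB0 : 0 ≤ B := (norm_nonneg _).trans (hB a (left_mem_Icc.2 hab))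
  have hsq : AbsolutelyContinuousOnInterval (fun t => ‖z t‖ ^ 2) a b := by
    refine LipschitzOnWith.absolutelyContinuousOnInterval (K := (2 * B * |L|).toNNReal) ?_
    rw [uIcc_of_le hab]
    refine LipschitzOnWith.of_dist_le' fun s hs t ht => ?_
    have h1 := hL s hs t ht
    have h2 := abs_norm_sub_norm_le (z s) (z t)
    have h3 : ‖z s‖ ^ 2 - ‖z t‖ ^ 2 = (‖z s‖ + ‖z t‖) * (‖z s‖ - ‖z t‖) := by ring
    rw [Real.dist_eq, Real.dist_eq, h3, abs_mul, abs_of_nonneg (by positivity)]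
    have h4 : L * |s - t| ≤ |L| * |s - t| :=
      mul_le_mul_of_nonneg_right (le_abs_self L) (abs_nonneg _)
    calc _ ≤ (2 * B) * (|L| * |s - t|) := by
          refine mul_le_mul (by linarith [hB s hs, hB t ht]) (by linarith) (abs_nonneg _)
            (by positivity)
      _ = _ := by ring
  have hexp : AbsolutelyContinuousOnInterval (fun t => Real.exp (-(C * t))) a b :=
    ContDiffOn.absolutelyContinuousOnInterval (ContDiff.contDiffOn (by fun_prop))
  have hlin : AbsolutelyContinuousOnInterval (fun t => c * t) a b :=
    ContDiffOn.absolutelyContinuousOnInterval (ContDiff.contDiffOn (by fun_prop))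
  have hF := (hexp.mul hsq).sub hlin
  refine hF.le_of_ae_deriv_nonpos hab ?_
  filter_upwards [hd] with t ht hmem
  obtain ⟨z', hz', hle⟩ := ht hmem
  have he : HasDerivAt (fun t => Real.exp (-(C * t))) (Real.exp (-(C * t)) * -(C * 1)) t :=
    (((hasDerivAt_id t).const_mul C).neg).exp
  -- The derivative is $e^{-Ct}(2\langle z,z'\rangle-C\|z\|^2)-c\le c(e^{-Ct}-1)\le0$.
  refine ⟨_, (he.mul hz'.norm_sq).sub ((hasDerivAt_id t).const_mul c), ?_⟩
  have hpos := Real.exp_pos (-(C * t))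
  have hle1 : Real.exp (-(C * t)) ≤ 1 :=
    Real.exp_le_one_iff.2 (neg_nonpos.2 (mul_nonneg hC (ha.trans hmem.1.le)))
  nlinarith

end Gronwall

/-! ### The differential inequality for the error -/

section ErrorEstimate

variable {k l : ℕ} {Δ : Type*} [Fintype Δ] {Ω : Set (Euc k)} {cell : Δ → Set (Euc k)}
  {M : Set (Euc l)}

theorem errC0_nonneg : 0 ≤ errC0 (l := l) M Ω cell := by
  have := chordConst_nonneg M
  have := lipTV_nonneg l Ω cell
  have : 0 ≤ minVol cell := Real.iInf_nonneg fun α => ENNReal.toReal_nonneg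
  unfold errC0
  positivity

theorem errC1_nonneg : 0 ≤ errC1 (l := l) M Ω cell := by
  have := chordConst_nonneg M
  have := curvBound_nonneg M
  have := lipTV_nonneg l Ω cell
  have : 0 ≤ minVol cell := Real.iInf_nonneg fun α => ENNReal.toReal_nonneg
  have : 0 ≤ Metric.diam M := Metric.diam_nonneg
  unfold errC1
  positivity

theorem errC2_nonneg : 0 ≤ errC2 (l := l) M Ω cell := by
  have := chordConst_nonneg M
  have := curvBound_nonneg M
  have := lipTV_nonneg l Ω cell
  have : 0 ≤ minVol cell := Real.iInf_nonneg fun α => ENNReal.toReal_nonneg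
  unfold errC2
  positivity

/-- One-sided monotonicity of the projected subdifferential. -/
theorem inner_projMaps_subdiffTV_le [Nonempty Δ] (h : IsRectPartition Ω cell) (hΩ : IsOpen Ω)
    (hb : Bornology.IsBounded Ω) (hM : IsC2Submanifold M) (hMc : IsCompact M)
    {u w ζ : Δ → Euc l} (hu : u ∈ mapsInto M) (hw : w ∈ mapsInto M)
    (hζ : ζ ∈ subdiffTV Ω cell u) :
    inner ℝ (hEmb cell (projMaps M u ζ)) (hEmb cell (w - u))
      ≤ discreteTV cell w - discreteTV cell u + lipTV l Ω cell
        * (chordConst M * minVol cell ^ (-(1 / 2) : ℝ) * ‖hEmb cell (w - u)‖ ^ 2) := by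
  rw [inner_projMaps_left]
  have e : projMaps M u (w - u) = (w - u) - (w - u - projMaps M u (w - u)) := by abel
  rw [e, map_sub, inner_sub_right]
  have h1 := inner_le_of_mem_subdiffTV h hΩ hb hζ w
  have h2 := neg_le_of_abs_le (abs_real_inner_le_norm (hEmb cell ζ)
    (hEmb cell (w - u - projMaps M u (w - u))))
  have h3 : ‖hEmb cell ζ‖ * ‖hEmb cell (w - u - projMaps M u (w - u))‖ ≤ lipTV l Ω cell
      * (chordConst M * minVol cell ^ (-(1 / 2) : ℝ) * ‖hEmb cell (w - u)‖ ^ 2) :=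
    mul_le_mul (norm_le_lipTV_of_mem_subdiffTV h hΩ hb hζ)
      (norm_sub_projMaps_le (h.minVol_pos hΩ hb) hM hMc hu hw) (norm_nonneg _)
      (lipTV_nonneg _ _ _)
  linarith

/-- The variational inequality of the scheme, tested with a map into `M`. -/
theorem inner_minimizer_le [Nonempty Δ] (h : IsRectPartition Ω cell) (hΩ : IsOpen Ω)
    (hb : Bornology.IsBounded Ω) (hM : IsC2Submanifold M) (hMc : IsCompact M) {τ : ℝ}
    (hτ : 0 < τ) {p X u : Δ → Euc l} (hp : p ∈ mapsInto M) (hu : u ∈ mapsInto M)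
    (hX : X ∈ tangentMaps M p)
    (hmin : IsMinOn (localEnergy Ω cell τ p) (tangentMaps M p) X) :
    inner ℝ (hEmb cell X) (hEmb cell (p + X - u))
      ≤ τ * (discreteTV cell u - discreteTV cell (p + X) + lipTV l Ω cell
        * (chordConst M * minVol cell ^ (-(1 / 2) : ℝ) * ‖hEmb cell (u - p)‖ ^ 2)) := by
  have h1 := inner_le_of_isMinOn_localEnergy h hΩ hb hτ hX hmin (projMaps_mem M p (u - p))
  have e1 : inner ℝ (hEmb cell X) (hEmb cell (projMaps M p (u - p)))
      = inner ℝ (hEmb cell X) (hEmb cell (u - p)) := by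
    rw [← inner_projMaps_left, projMaps_eq_self hX]
  have e2 : p + X - u = X - (u - p) := by abel
  rw [e2, map_sub, inner_sub_right]
  rw [map_sub, inner_sub_right, e1] at h1
  refine h1.trans (mul_le_mul_of_nonneg_left ?_ hτ.le)
  have h2 := discreteTV_sub_le_lipTV h hΩ hb (p + projMaps M p (u - p)) u
  have e3 : p + projMaps M p (u - p) - u = -(u - p - projMaps M p (u - p)) := by abel
  rw [e3, map_neg, norm_neg] at h2
  have h3 := mul_le_mul_of_nonneg_left
    (norm_sub_projMaps_le (h.minVol_pos hΩ hb) hM hMc hp hu) (lipTV_nonneg l Ω cell)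
  linarith

/-- The differential inequality at one instant: `s` is the rescaled time within the step, `w` the
point on the geodesic arc, `w'` its velocity in `s`. -/
theorem two_mul_inner_velocity_sub_le [Nonempty Δ] (h : IsRectPartition Ω cell) (hΩ : IsOpen Ω)
    (hb : Bornology.IsBounded Ω) (hM : IsC2Submanifold M) (hMc : IsCompact M) {τ : ℝ}
    (hτ : 0 < τ) {p X u w w' ζ : Δ → Euc l} {s : ℝ} (hs : s ∈ Icc (0 : ℝ) 1)
    (hp : p ∈ mapsInto M) (hu : u ∈ mapsInto M) (hw : w ∈ mapsInto M)
    (hX : X ∈ tangentMaps M p)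
    (hmin : IsMinOn (localEnergy Ω cell τ p) (tangentMaps M p) X)
    (hζ : ζ ∈ subdiffTV Ω cell u)
    (hw1 : ∀ α, ‖w' α - X α‖ ≤ curvBound M * ‖X α‖ ^ 2 * s)
    (hw2 : ∀ α, ‖w α - p α‖ ≤ ‖X α‖ * s)
    (hw3 : ∀ α, ‖w α - p α - s • X α‖ ≤ curvBound M * ‖X α‖ ^ 2 * (s ^ 2 / 2)) :
    2 * inner ℝ (hEmb cell (w - u)) (hEmb cell (τ⁻¹ • w' - -projMaps M u ζ))
      ≤ errC0 M Ω cell * ‖hEmb cell (w - u)‖ ^ 2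
        + (errC1 M Ω cell * τ + errC2 M Ω cell * τ ^ 2) := by
  have hv := h.minVol_pos hΩ hb
  have hCu := curvBound_nonneg M
  have hCh := chordConst_nonneg M
  have hΛ := lipTV_nonneg l Ω cell
  have hdiam : ∀ α, ‖(w - u) α‖ ≤ Metric.diam M := fun α => by
    rw [Pi.sub_apply, ← dist_eq_norm]
    exact Metric.dist_le_diam_of_mem hMc.isBounded (hw α) (hu α)
  have hδ := norm_hEmb_le_of_bound h hΩ hb Metric.diam_nonneg hdiam
  have hδ0 : 0 ≤ Metric.diam M * (volume Ω).toReal ^ (1 / 2 : ℝ) :=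
    mul_nonneg Metric.diam_nonneg (Real.rpow_nonneg ENNReal.toReal_nonneg _)
  have hκ : 0 ≤ minVol cell ^ (-(1 / 2) : ℝ) := Real.rpow_nonneg hv.le _
  have hx := norm_le_of_isMinOn_localEnergy h hΩ hb hτ hX hmin
  have hA := inner_projMaps_subdiffTV_le h hΩ hb hM hMc hu hw hζ
  have hB := inner_minimizer_le h hΩ hb hM hMc hτ hp hu hX hmin
  have hR : ‖hEmb cell (w' - X)‖
      ≤ curvBound M * s * minVol cell ^ (-(1 / 2) : ℝ) * ‖hEmb cell X‖ ^ 2 :=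
    norm_hEmb_le_of_sq hv (mul_nonneg hCu hs.1) fun α => (hw1 α).trans_eq (by ring)
  have hE1 : ‖hEmb cell (w - p - s • X)‖
      ≤ curvBound M * (s ^ 2 / 2) * minVol cell ^ (-(1 / 2) : ℝ) * ‖hEmb cell X‖ ^ 2 :=
    norm_hEmb_le_of_sq hv (mul_nonneg hCu (by positivity)) fun α => (hw3 α).trans_eq (by ring)
  have hP : ‖hEmb cell (w - p)‖ ≤ s * ‖hEmb cell X‖ :=
    norm_hEmb_le_of_le cell hs.1 fun α => (hw2 α).trans_eq (by ring)
  have hC := discreteTV_sub_le_lipTV h hΩ hb w (p + X)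
  set κ := minVol cell ^ (-(1 / 2) : ℝ) with hκdef
  set δ := Metric.diam M * (volume Ω).toReal ^ (1 / 2 : ℝ) with hδdef
  set Λ := lipTV l Ω cell with hΛdef
  set Cu := curvBound M with hCudef
  set Ch := chordConst M with hChdef
  set N := ‖hEmb cell (w - u)‖ with hN
  set x := ‖hEmb cell X‖ with hxdef
  have hx0 : 0 ≤ x := norm_nonneg _
  have hx2 : x ^ 2 ≤ (τ * Λ) ^ 2 := by gcongr
  have hs2 : s ^ 2 ≤ 1 := pow_le_one₀ hs.1 hs.2
  -- the distance to the linear extrapolation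
  have hE : ‖hEmb cell (w - (p + X))‖ ≤ τ * Λ + Cu * κ * (τ * Λ) ^ 2 / 2 := by
    have e : w - (p + X) = (w - p - s • X) - (1 - s) • X := by module
    rw [e, map_sub, map_smul]
    refine (norm_sub_le _ _).trans ?_
    rw [norm_smul, Real.norm_of_nonneg (sub_nonneg.2 hs.2)]
    have h1 : Cu * (s ^ 2 / 2) * κ * x ^ 2 ≤ Cu * (1 / 2) * κ * (τ * Λ) ^ 2 := by gcongr
    have h2 : (1 - s) * x ≤ 1 * (τ * Λ) := by
      gcongr
      linarith [hs.1]
    linarith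
  -- In the cross term one factor `N` is replaced by the diameter bound `δ`, so that it contributes
  -- to the order $\tau$ term.
  have hPU : ‖hEmb cell (u - p)‖ ^ 2 ≤ N ^ 2 + 2 * δ * (τ * Λ) + (τ * Λ) ^ 2 := by
    have e : u - p = (w - p) - (w - u) := by abel
    have h0 : ‖hEmb cell (w - p)‖ ≤ τ * Λ := by
      refine hP.trans ?_
      calc s * x ≤ 1 * (τ * Λ) := by gcongr; exact hs.2
        _ = _ := one_mul _
    have h1 : ‖hEmb cell (u - p)‖ ≤ ‖hEmb cell (w - p)‖ + N := by
      rw [e, map_sub]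
      exact norm_sub_le _ _
    calc ‖hEmb cell (u - p)‖ ^ 2 ≤ (τ * Λ + N) ^ 2 := by
          gcongr
          linarith
      _ = N ^ 2 + 2 * N * (τ * Λ) + (τ * Λ) ^ 2 := by ring
      _ ≤ _ := by gcongr
  -- `w'` is replaced by `X`, and `w - u` is split at the linear extrapolation `p + X`, where the
  -- variational inequality for `X` applies.
  have hsplit : inner ℝ (hEmb cell (w - u)) (hEmb cell (τ⁻¹ • w' - -projMaps M u ζ))
      = τ⁻¹ * (inner ℝ (hEmb cell (w' - X)) (hEmb cell (w - u))
          + inner ℝ (hEmb cell X) (hEmb cell (w - (p + X)))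
          + inner ℝ (hEmb cell X) (hEmb cell (p + X - u)))
        + inner ℝ (hEmb cell (projMaps M u ζ)) (hEmb cell (w - u)) := by
    rw [add_assoc, ← inner_add_right, ← map_add, sub_add_sub_cancel, ← inner_add_left, ← map_add,
      sub_add_cancel, ← real_inner_smul_left, ← inner_add_left, real_inner_comm, ← map_smul,
      ← map_add, sub_neg_eq_add]
  have hT1 : inner ℝ (hEmb cell (w' - X)) (hEmb cell (w - u))
      ≤ τ * (Cu * κ * δ * Λ ^ 2 * τ) := by
    refine (real_inner_le_norm _ _).trans ?_
    calc _ ≤ (Cu * 1 * κ * (τ * Λ) ^ 2) * δ := by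
          refine mul_le_mul (hR.trans ?_) hδ (norm_nonneg _) (by positivity)
          gcongr
          exact hs.2
      _ = _ := by ring
  have hT2 : inner ℝ (hEmb cell X) (hEmb cell (w - (p + X)))
      ≤ τ * (Λ * (τ * Λ + Cu * κ * (τ * Λ) ^ 2 / 2)) := by
    refine (real_inner_le_norm _ _).trans ?_
    calc _ ≤ (τ * Λ) * (τ * Λ + Cu * κ * (τ * Λ) ^ 2 / 2) :=
          mul_le_mul hx hE (norm_nonneg _) (by positivity)
      _ = _ := by ring
  have hsum : τ⁻¹ * (inner ℝ (hEmb cell (w' - X)) (hEmb cell (w - u))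
          + inner ℝ (hEmb cell X) (hEmb cell (w - (p + X)))
          + inner ℝ (hEmb cell X) (hEmb cell (p + X - u)))
      ≤ Cu * κ * δ * Λ ^ 2 * τ + Λ * (τ * Λ + Cu * κ * (τ * Λ) ^ 2 / 2)
        + (discreteTV cell u - discreteTV cell (p + X)
          + Λ * (Ch * κ * ‖hEmb cell (u - p)‖ ^ 2)) := by
    rw [inv_mul_le_iff₀ hτ]
    linarith
  have hq1 : Λ * (Ch * κ * ‖hEmb cell (u - p)‖ ^ 2)
      ≤ Λ * (Ch * κ * (N ^ 2 + 2 * δ * (τ * Λ) + (τ * Λ) ^ 2)) := by gcongr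
  have hq2 : Λ * ‖hEmb cell (w - (p + X))‖ ≤ Λ * (τ * Λ + Cu * κ * (τ * Λ) ^ 2 / 2) := by gcongr
  -- The estimates produce only $\mathrm{Curv}(M)$ where $C_2$ has $\tfrac32\mathrm{Curv}(M)$; this
  -- is the unused remainder.
  have hslack : 0 ≤ Cu * κ * Λ ^ 3 * τ ^ 2 := by positivity
  have hc0 : errC0 M Ω cell = 4 * Ch * Λ * κ := rfl
  have hc1 : errC1 M Ω cell = 2 * (2 + δ * κ * (2 * Ch + Cu)) * Λ ^ 2 := rfl
  have hc2 : errC2 M Ω cell = 2 * (3 / 2 * Cu + Ch) * κ * Λ ^ 3 := rfl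
  rw [hsplit, hc0, hc1, hc2]
  linarith

end ErrorEstimate

theorem LinearMap.exists_continuousLinearMap_eq {E F : Type*} [NormedAddCommGroup E]
    [NormedSpace ℝ E] [FiniteDimensional ℝ E] [NormedAddCommGroup F] [NormedSpace ℝ F]
    (f : E →ₗ[ℝ] F) : ∃ Φ : E →L[ℝ] F, ∀ x, Φ x = f x :=
  ⟨LinearMap.toContinuousLinearMap f, fun _ => rfl⟩

/-! ### Comparison of the solution with the Rothe interpolation, step by step -/

section Comparison

variable {k l : ℕ} {Δ : Type*} [Fintype Δ] {Ω : Set (Euc k)} {cell : Δ → Set (Euc k)}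
  {M : Set (Euc l)}

/-- A solution of the discrete model is Lipschitz and solves the differential inclusion a.e. -/
theorem IsGKSolution.lipschitz_and_ae_hasDerivAt (h : IsRectPartition Ω cell) (hΩ : IsOpen Ω)
    (hb : Bornology.IsBounded Ω) {T : ℝ} (hT : 0 < T) {u₀ : Δ → Euc l} {u : ℝ → Δ → Euc l}
    (hu : IsGKSolution M Ω cell T u₀ u) :
    u 0 = u₀ ∧ (∃ B : ℝ, ∀ s ∈ Ico 0 T, ∀ t ∈ Ico 0 T, ‖u s - u t‖ ≤ B * |s - t|) ∧
      ∀ᵐ t, t ∈ Ioo 0 T → ∃ ζ ∈ subdiffTV Ω cell (u t),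
        HasDerivAt u (-projMaps M (u t) ζ) t := by
  obtain ⟨-, g, hg, hug, hincl⟩ := hu
  have hinj := hEmb_injective (l := l) (h.cellVol_pos hΩ hb)
  obtain ⟨K, -, hK⟩ := LinearMap.exists_antilipschitzWith (hEmb (l := l) cell)
    (LinearMap.ker_eq_bot.2 hinj)
  have hincl' := (ae_restrict_iff' measurableSet_Ioo).1 hincl
  -- Subgradients are bounded by the Lipschitz constant and the projection does not increase norms,
  -- so the $L^2$ derivative is in fact bounded.
  have hbound : ∀ᵐ t, t ∈ Ioo 0 T → ‖g t‖ ≤ K * lipTV l Ω cell := by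
    filter_upwards [hincl'] with t ht hmem
    obtain ⟨ζ, hζ, hgζ⟩ := ht hmem
    have h1 : ‖g t‖ ≤ K * ‖hEmb cell (g t)‖ := by simpa using hK.le_mul_dist (g t) 0
    refine h1.trans (mul_le_mul_of_nonneg_left ?_ K.2)
    rw [hgζ, map_neg, norm_neg]
    exact (norm_hEmb_projMaps_le cell M (u t) ζ).trans (norm_le_lipTV_of_mem_subdiffTV h hΩ hb hζ)
  have hint : IntervalIntegrable g volume 0 T := by
    rw [intervalIntegrable_iff_integrableOn_Ioo_of_le hT.le]
    exact hg.integrable one_le_two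
  have hint' : ∀ s ∈ Ico 0 T, IntervalIntegrable g volume 0 s := fun s hs =>
    hint.mono_set (by
      rw [uIcc_of_le hs.1, uIcc_of_le hT.le]
      exact Icc_subset_Icc_right hs.2.le)
  refine ⟨?_, ⟨K * lipTV l Ω cell, fun s hs t ht => ?_⟩, ?_⟩
  · simpa using hug 0 ⟨le_rfl, hT⟩
  · rw [hug s hs, hug t ht, add_sub_add_left_eq_sub,
      intervalIntegral.integral_interval_sub_left (hint' s hs) (hint' t ht)]
    refine intervalIntegral.norm_integral_le_of_norm_le_const_ae ?_
    filter_upwards [hbound] with x hx hmem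
    rw [uIoc, mem_Ioc] at hmem
    exact hx ⟨(le_min ht.1 hs.1).trans_lt hmem.1, hmem.2.trans_lt (max_lt ht.2 hs.2)⟩
  · filter_upwards [hint.ae_hasDerivAt_integral, hincl'] with t ht hi hmem
    obtain ⟨ζ, hζ, hgζ⟩ := hi hmem
    refine ⟨ζ, hζ, ?_⟩
    rw [← hgζ]
    have hmem' : t ∈ uIcc 0 T := by
      rw [uIcc_of_le hT.le]
      exact Ioo_subset_Icc_self hmem
    refine ((ht hmem' 0 left_mem_uIcc).const_add u₀).congr_of_eventuallyEq ?_
    filter_upwards [isOpen_Ioo.mem_nhds hmem] with x hx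
    exact hug x (Ioo_subset_Ico_self hx)

/-- The time-rescaled product of geodesics used as one step of the Rothe interpolation. -/
theorem exists_rescaled_geodesic_velocity (hM : IsC2Submanifold M) (hMc : IsCompact M) {τ : ℝ}
    (hτ : 0 < τ) (a : ℝ) {p X : Δ → Euc l} {γ : Δ → ℝ → Euc l}
    (hγ : ∀ α, IsGeodesic M (p α) (X α) (γ α)) :
    ∃ w' : ℝ → Δ → Euc l,
      (∀ t ∈ Ici a, HasDerivWithinAt (fun t α => γ α ((t - a) / τ)) (τ⁻¹ • w' t) (Ici a) t) ∧
      (∀ s ∈ Ici a, ∀ t ∈ Ici a,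
        ‖(fun α => γ α ((s - a) / τ)) - fun α => γ α ((t - a) / τ)‖ ≤ τ⁻¹ * ‖X‖ * |s - t|) ∧
      ∀ t ∈ Ici a, ∀ α,
        ‖w' t α - X α‖ ≤ curvBound M * ‖X α‖ ^ 2 * ((t - a) / τ) ∧
        ‖γ α ((t - a) / τ) - p α‖ ≤ ‖X α‖ * ((t - a) / τ) ∧
        ‖γ α ((t - a) / τ) - p α - ((t - a) / τ) • X α‖
          ≤ curvBound M * ‖X α‖ ^ 2 * (((t - a) / τ) ^ 2 / 2) := by
  choose γ' hd hspeed hvel hpos hexp using fun α => (hγ α).exists_velocity hM hMc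
  have hmaps : MapsTo (fun t => (t - a) / τ) (Ici a) (Ici 0) := fun t ht =>
    div_nonneg (sub_nonneg.2 ht) hτ.le
  have hwd : ∀ t ∈ Ici a, HasDerivWithinAt (fun t α => γ α ((t - a) / τ))
      (τ⁻¹ • fun α => γ' α ((t - a) / τ)) (Ici a) t := by
    intro t ht
    refine hasDerivWithinAt_pi.2 fun α => ?_
    have h1 : HasDerivWithinAt (fun t => (t - a) / τ) (1 / τ) (Ici a) t :=
      ((hasDerivWithinAt_id t (Ici a)).sub_const a).div_const τ
    have h2 := (hd α _ (hmaps ht)).scomp t h1 hmaps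
    rw [one_div] at h2
    exact h2
  refine ⟨fun t α => γ' α ((t - a) / τ), hwd, fun s hs t ht => ?_, fun t ht α =>
    ⟨hvel α _ (hmaps ht), hpos α _ (hmaps ht), hexp α _ (hmaps ht)⟩⟩
  refine (convex_Ici a).norm_image_sub_le_of_norm_hasDerivWithin_le hwd (fun x hx => ?_) ht hs
  rw [norm_smul, Real.norm_of_nonneg (inv_nonneg.2 hτ.le)]
  refine mul_le_mul_of_nonneg_left ?_ (inv_nonneg.2 hτ.le)
  refine (pi_norm_le_iff_of_nonneg (norm_nonneg _)).2 fun α => ?_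
  rw [hspeed α _ (hmaps hx)]
  exact norm_le_pi_norm X α

/-- The error estimate along a single step of the scheme. -/
theorem exp_mul_norm_sq_step_le [Nonempty Δ] (h : IsRectPartition Ω cell) (hΩ : IsOpen Ω)
    (hb : Bornology.IsBounded Ω) (hM : IsC2Submanifold M) (hMc : IsCompact M) {T τ : ℝ}
    (hT : 0 < T) (hτ : 0 < τ) {u₀ : Δ → Euc l} {u : ℝ → Δ → Euc l}
    (hu : IsGKSolution M Ω cell T u₀ u) {a b : ℝ} (ha : 0 ≤ a) (hab : a ≤ b) (hbT : b < T)
    (hbτ : b ≤ a + τ) {p X : Δ → Euc l} {γ : Δ → ℝ → Euc l} (hp : p ∈ mapsInto M)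
    (hX : X ∈ tangentMaps M p)
    (hmin : IsMinOn (localEnergy Ω cell τ p) (tangentMaps M p) X)
    (hγ : ∀ α, IsGeodesic M (p α) (X α) (γ α)) :
    Real.exp (-(errC0 M Ω cell * b)) * ‖hEmb cell ((fun α => γ α ((b - a) / τ)) - u b)‖ ^ 2
        - (errC1 M Ω cell * τ + errC2 M Ω cell * τ ^ 2) * b
      ≤ Real.exp (-(errC0 M Ω cell * a)) * ‖hEmb cell (p - u a)‖ ^ 2
        - (errC1 M Ω cell * τ + errC2 M Ω cell * τ ^ 2) * a := by
  obtain ⟨-, ⟨B, hB⟩, hder⟩ := hu.lipschitz_and_ae_hasDerivAt h hΩ hb hT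
  obtain ⟨w', hwd, hwL, hest⟩ := exists_rescaled_geodesic_velocity hM hMc hτ a hγ
  obtain ⟨w, hw⟩ : ∃ w : ℝ → Δ → Euc l, w = fun t α => γ α ((t - a) / τ) := ⟨_, rfl⟩
  have hwt : ∀ t, (fun α => γ α ((t - a) / τ)) = w t := fun t => by rw [hw]
  have hwα : ∀ t α, γ α ((t - a) / τ) = w t α := fun t α => by rw [hw]
  have hw0 : w a = p := by
    funext α
    rw [← hwα, sub_self, zero_div]
    exact (hγ α).1
  have hwM : ∀ t ∈ Ici a, w t ∈ mapsInto M := fun t ht α => by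
    rw [← hwα]
    exact (hγ α).2.1 _ (div_nonneg (sub_nonneg.2 ht) hτ.le)
  simp only [hwt] at hwL ⊢
  simp only [hwα] at hest
  rw [← hw] at hwd
  obtain ⟨Φ, hΦ⟩ : ∃ Φ : (Δ → Euc l) →L[ℝ] PiLp 2 (fun _ : Δ => Euc l),
      ∀ U, Φ U = hEmb cell U := (hEmb cell).exists_continuousLinearMap_eq
  have hsub : Icc a b ⊆ Ico 0 T := fun t ht => ⟨ha.trans ht.1, ht.2.trans_lt hbT⟩
  have hL : ∀ s ∈ Icc a b, ∀ t ∈ Icc a b,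
      ‖Φ (w s - u s) - Φ (w t - u t)‖ ≤ ‖Φ‖ * (τ⁻¹ * ‖X‖ + B) * |s - t| := by
    intro s hs t ht
    rw [← map_sub, sub_sub_sub_comm, mul_assoc]
    refine Φ.le_opNorm_of_le ((norm_sub_le _ _).trans ?_)
    rw [add_mul]
    exact add_le_add (hwL s hs.1 t ht.1) (hB s (hsub hs) t (hsub ht))
  have hc : 0 ≤ errC1 (l := l) M Ω cell * τ + errC2 M Ω cell * τ ^ 2 :=
    add_nonneg (mul_nonneg errC1_nonneg hτ.le) (mul_nonneg errC2_nonneg (sq_nonneg τ))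
  have key := exp_mul_norm_sq_sub_le (z := fun t => Φ (w t - u t)) ha hab
    (errC0_nonneg (M := M) (Ω := Ω) (cell := cell)) hc hL ?_
  · simp only [hΦ, hw0] at key
    exact key
  · filter_upwards [hder] with t ht hmem
    obtain ⟨ζ, hζ, hu'⟩ := ht ⟨ha.trans_lt hmem.1, hmem.2.trans hbT⟩
    have hw' := (hwd t (mem_Ici.2 hmem.1.le)).hasDerivAt (Ici_mem_nhds hmem.1)
    refine ⟨_, Φ.hasFDerivAt.comp_hasDerivAt t (hw'.sub hu'), ?_⟩
    have hta : t ∈ Ici a := mem_Ici.2 hmem.1.le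
    simp only [hΦ]
    refine two_mul_inner_velocity_sub_le h hΩ hb hM hMc hτ (s := (t - a) / τ)
      ⟨div_nonneg (sub_nonneg.2 hta) hτ.le, ?_⟩ hp
      (hu.1 t ⟨ha.trans hmem.1.le, hmem.2.trans hbT⟩) (hwM t hta) hX hmin hζ
      (fun α => (hest t hta α).1) (fun α => (hest t hta α).2.1) (fun α => (hest t hta α).2.2)
    rw [div_le_one hτ]
    linarith [hmem.2]

/-- Induction over the nodes $n\tau<T$ chains the single-step estimates, and one partial step
reaches `t`. Nodes at or beyond `T` are never needed. -/
theorem IsRotheInterpolation.norm_sq_sub_le [Nonempty Δ] (h : IsRectPartition Ω cell)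
    (hΩ : IsOpen Ω) (hb : Bornology.IsBounded Ω) (hM : IsC2Submanifold M) (hMc : IsCompact M)
    {T τ : ℝ} (hT : 0 < T) (hτ : 0 < τ) {u₀₁ u₀₂ : Δ → Euc l} (hu₀₂ : u₀₂ ∈ mapsInto M)
    {u uτ : ℝ → Δ → Euc l} (hu : IsGKSolution M Ω cell T u₀₁ u)
    (huτ : IsRotheInterpolation M Ω cell T τ u₀₂ uτ) {t : ℝ} (ht : t ∈ Ico 0 T) :
    ‖hEmb cell (uτ t - u t)‖ ^ 2 ≤
      Real.exp (errC0 M Ω cell * t) * ‖hEmb cell (u₀₁ - u₀₂)‖ ^ 2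
        + t * Real.exp (errC0 M Ω cell * t)
          * (errC1 M Ω cell * τ + errC2 M Ω cell * τ ^ 2) := by
  obtain ⟨p, X, γ, hp0, hstep⟩ := huτ
  have hu0 := (hu.lipschitz_and_ae_hasDerivAt h hΩ hb hT).1
  have hlt : ∀ {n : ℕ} {t : ℝ}, t < T → n * τ ≤ t → n < numSteps T τ := fun {n t} ht hn => by
    refine Nat.lt_succ_of_le (Nat.le_floor ?_)
    rw [le_div_iff₀ hτ]
    exact hn.trans ht.le
  have hmaps : ∀ n : ℕ, n * τ < T → p n ∈ mapsInto M := by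
    intro n
    induction n with
    | zero => exact fun _ => hp0 ▸ hu₀₂
    | succ n ih =>
      intro hn α
      have hn' : n * τ < T := lt_of_le_of_lt (by gcongr; simp) hn
      obtain ⟨-, -, hγ, hnext, -⟩ := hstep n (hlt hn' le_rfl)
      rw [hnext α]
      exact (hγ α).2.1 1 (mem_Ici.2 zero_le_one)
  have hnode : ∀ n : ℕ, n * τ < T →
      Real.exp (-(errC0 M Ω cell * (n * τ))) * ‖hEmb cell (p n - u (n * τ))‖ ^ 2
          - (errC1 M Ω cell * τ + errC2 M Ω cell * τ ^ 2) * (n * τ)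
        ≤ ‖hEmb cell (u₀₁ - u₀₂)‖ ^ 2 := by
    intro n
    induction n with
    | zero =>
      intro _
      simp only [Nat.cast_zero, zero_mul, mul_zero, neg_zero, Real.exp_zero, one_mul, sub_zero]
      rw [hp0, hu0, ← neg_sub, map_neg, norm_neg]
    | succ n ih =>
      intro hn
      have hle : (n : ℝ) * τ ≤ (n + 1 : ℕ) * τ := by gcongr; simp
      have hn' : n * τ < T := hle.trans_lt hn
      obtain ⟨hX, hmin, hγ, hnext, -⟩ := hstep n (hlt hn' le_rfl)
      have key := exp_mul_norm_sq_step_le h hΩ hb hM hMc hT hτ hu (a := n * τ)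
        (b := (n + 1 : ℕ) * τ) (by positivity) hle hn (by push_cast; linarith) (hmaps n hn') hX
        hmin hγ
      have e : (fun α => γ n α ((((n + 1 : ℕ) : ℝ) * τ - n * τ) / τ)) = p (n + 1) := by
        funext α
        rw [hnext α]
        congr 1
        push_cast
        field_simp
        ring
      rw [e] at key
      exact key.trans (ih hn')
  -- The index of the step containing `t`; the next node is `(n + 1) * τ` or the truncated value
  -- `T`, and `t` lies below it in both cases.
  set n := ⌊t / τ⌋₊ with hn
  have hnt : n * τ ≤ t := by
    have := Nat.floor_le (div_nonneg ht.1 hτ.le)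
    rwa [le_div_iff₀ hτ] at this
  have htn : t < (n + 1 : ℕ) * τ := by
    have := Nat.lt_floor_add_one (t / τ)
    rw [div_lt_iff₀ hτ] at this
    push_cast
    exact this
  have hnN := hlt ht.2 hnt
  have hnT : n * τ < T := hnt.trans_lt ht.2
  obtain ⟨hX, hmin, hγ, -, hval⟩ := hstep n hnN
  have htime : timeNode T τ n = n * τ := if_pos hnN
  have htime' : t < timeNode T τ (n + 1) := by
    unfold timeNode
    split_ifs
    · exact htn
    · exact ht.2
  have key := exp_mul_norm_sq_step_le h hΩ hb hM hMc hT hτ hu (a := n * τ) (b := t)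
    (by positivity) hnt ht.2 (by push_cast at htn; linarith) (hmaps n hnT) hX hmin hγ
  have e : (fun α => γ n α ((t - n * τ) / τ)) = uτ t := by
    funext α
    have := hval t ⟨htime.le.trans hnt, htime'⟩ α
    rw [htime] at this
    exact this.symm
  rw [e] at key
  have hfin := key.trans (hnode n hnT)
  -- Multiplying by $e^{C_0t}$ turns the monotone quantity back into the error itself.
  have hE : Real.exp (errC0 M Ω cell * t) * Real.exp (-(errC0 M Ω cell * t)) = 1 := by
    rw [← Real.exp_add, add_neg_cancel, Real.exp_zero]
  have hmul := mul_le_mul_of_nonneg_left hfin (Real.exp_pos (errC0 M Ω cell * t)).le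
  rw [mul_sub, ← mul_assoc, hE, one_mul] at hmul
  linarith

end Comparison

theorem IsRectPartition.nonempty_index {k : ℕ} {Δ : Type*} {Ω : Set (Euc k)}
    {cell : Δ → Set (Euc k)} (h : IsRectPartition Ω cell) (hΩ : IsOpen Ω) (hne : Ω.Nonempty) :
    Nonempty Δ := by
  by_contra hempty
  rw [not_nonempty_iff] at hempty
  have := h.cover
  rw [iUnion_of_empty, sdiff_empty] at this
  exact (hΩ.measure_pos volume hne).ne' this

end

theorem theorem3p1 {k l : ℕ} (hk : 1 ≤ k) {Δ : Type*} [Fintype Δ]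
    (Ω : Set (Euc k)) (hΩo : IsOpen Ω) (hΩc : IsConnected Ω) (hΩb : Bornology.IsBounded Ω)
    (cell : Δ → Set (Euc k)) (hcell : IsRectPartition Ω cell)
    (M : Set (Euc l)) (hM : IsC2Submanifold M) (hMc : IsCompact M) (hMp : IsPathConnected M)
    (T : ℝ) (hT : 0 < T) :
    (∀ u₀₁ ∈ mapsInto (Δ := Δ) M, ∀ u₀₂ ∈ mapsInto (Δ := Δ) M,
      ∀ u : ℝ → Δ → Euc l, IsGKSolution M Ω cell T u₀₁ u →
      ∀ τ : ℝ, 0 < τ →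
      ∀ uτ : ℝ → Δ → Euc l, IsRotheInterpolation M Ω cell T τ u₀₂ uτ →
      ∀ t ∈ Set.Ico 0 T,
        hNorm Ω cell (uτ t - u t) ^ 2 ≤
          Real.exp (errC0 M Ω cell * t) * hNorm Ω cell (u₀₁ - u₀₂) ^ 2
            + t * Real.exp (errC0 M Ω cell * t)
              * (errC1 M Ω cell * τ + errC2 M Ω cell * τ ^ 2)) ∧
    ∃ K : ℝ, ∀ u₀ ∈ mapsInto (Δ := Δ) M,
      ∀ u : ℝ → Δ → Euc l, IsGKSolution M Ω cell T u₀ u →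
      ∀ τ : ℝ, 0 < τ → τ ≤ 1 →
      ∀ uτ : ℝ → Δ → Euc l, IsRotheInterpolation M Ω cell T τ u₀ uτ →
      ∀ t ∈ Set.Ico 0 T, hNorm Ω cell (uτ t - u t) ≤ K * Real.sqrt τ := by
  -- For an empty family the infimum `minVol` would take the default value `0`; its positivity
  -- requires a cell.
  have : Nonempty Δ := hcell.nonempty_index hΩo hΩc.nonempty
  simp only [hNorm_eq_norm hcell hΩo hΩb]
  refine ⟨fun u₀₁ _ u₀₂ hu₀₂ u hu τ hτ uτ huτ t ht =>
    huτ.norm_sq_sub_le hcell hΩo hΩb hM hMc hT hτ hu₀₂ hu ht, ?_⟩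
  set C := errC1 M Ω cell + errC2 M Ω cell with hC
  have h0 := errC0_nonneg (M := M) (Ω := Ω) (cell := cell)
  have h1 := errC1_nonneg (M := M) (Ω := Ω) (cell := cell)
  have h2 := errC2_nonneg (M := M) (Ω := Ω) (cell := cell)
  -- For equal initial data only the second term remains; $\tau^2\le\tau$ and $t\le T$ bound it by
  -- $Te^{C_0T}(C_1+C_2)\tau$.
  refine ⟨√(T * Real.exp (errC0 M Ω cell * T) * C), fun u₀ hu₀ u hu τ hτ hτ1 uτ huτ t ht => ?_⟩
  have key := huτ.norm_sq_sub_le hcell hΩo hΩb hM hMc hT hτ hu₀ hu ht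
  rw [sub_self, map_zero, norm_zero, zero_pow two_ne_zero, mul_zero, zero_add] at key
  rw [← Real.sqrt_mul (by positivity)]
  refine Real.le_sqrt_of_sq_le (key.trans ?_)
  have hsq : τ ^ 2 ≤ τ := by nlinarith
  have hlin : errC1 M Ω cell * τ + errC2 M Ω cell * τ ^ 2 ≤ C * τ := by
    have := mul_le_mul_of_nonneg_left hsq h2
    rw [hC, add_mul]
    linarith
  have ht0 := ht.1
  calc t * Real.exp (errC0 M Ω cell * t) * (errC1 M Ω cell * τ + errC2 M Ω cell * τ ^ 2)
      ≤ T * Real.exp (errC0 M Ω cell * T) * (C * τ) := by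
        gcongr
        · exact ht.2.le
        · exact ht.2.le
    _ = _ := by ring
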